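/- **Setting.** A stochastic graph $G$ consists of a finite set $U$ of offline vertices, a finite set $V$ of online vertices, $n=|V|$, and, for every edge $(u,v)\in U\times V$, a probability $p_{u,v}\in[0,1]$ and a real weight $w_{u,v}$, and for every $v\in V$ a patience $\ell_v\in\mathbb N$. Each edge $(u,v)$ is independently *active* with probability $p_{u,v}$; whether it is active is revealed by *probing* it. Let $\mathrm{OPT}(G)$ (the *committal benchmark*) be the largest expected weight of the matching built by an offline algorithm that knows $G$ and probes edges adaptively, in any order, makes at most $\ell_v$ probes to edges at $v$ for each $v\in V$, and must add a probed edge to its matching whenever the edge is active and both its endpoints are currently unmatched (no other edges are added). For $v\in V$ let $U^{(\le \ell_v)}$ be the set of tuples $\boldsymbol u=(u_1,\dots,u_k)$ of distinct elements of $U$ with $1\le k\le \ell_v$, and let $g_v^i(\boldsymbol u)=p_{u_i,v}\prod_{j<i}(1-p_{u_j,v})$. The linear program LP-new for $G$, in the variables $x_v(\boldsymbol u)\ge 0$ ($v\in V$, $\boldsymbol u\in U^{(\le \ell_v)}$), is $$\max \sum_{v\in V}\sum_{\boldsymbol u\in U^{(\le \ell_v)}}\Big(\sum_{i=1}^{|\boldsymbol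 u|}w_{u_i,v}\,g_v^i(\boldsymbol u)\Big)x_v(\boldsymbol u)\quad\text{subject to}$$ $$\sum_{v\in V}\ \sum_{\boldsymbol u\in U^{(\le \ell_v)}}\ \sum_{i:\,u_i=u}g_v^i(\boldsymbol u)\,x_v(\boldsymbol u)\le 1\quad(u\in U),\qquad \sum_{\boldsymbol u\in U^{(\le \ell_v)}}x_v(\boldsymbol u)\le 1\quad(v\in V).$$ **Algorithm.** The algorithm initially knows only $U$ and $n$. The online vertices arrive in a uniformly random order $v_1,\dots,v_n$; with $v_t$, its patience $\ell_{v_t}$ and all $p_{u,v_t},w_{u,v_t}$ ($u\in U$) are revealed. Start with the empty matching. If $t<n/e$, pass on $v_t$. If $t\ge n/e$, compute an optimum solution $x$ of LP-new for the stochastic graph $G_t$ induced by $U$ and $V_t=\{v_1,\dots,v_t\}$; the solution is determined by $G_t$ (a stochastic graph with labelled vertices), not by the order of the arrivals in $V_t$. Then run VertexProbe at $v_t$: draw $\boldsymbol u\in U^{(\le \ell_{v_t})}$ with probability $x_{v_t}(\boldsymbol u)$, or nothing with probability $1-\sum_{\boldsymbol u}x_{v_t}(\boldsymbol u)$, independently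 of everything else given the order; probe $(u_1,v_t),(u_2,v_t),\dots$ in order up to the first active edge; if there is one, $(u_i,v_t)$, and $u_i$ is currently unmatched, add $(u_i,v_t)$ to the matching. Let $\mathbb E[\mathrm{val}(\mathcal A(G))]$ be the expected weight of the matching returned, over the arrival order, the edge states and the random draws. **Theorem.** For every choice of optimum solutions of LP-new (one for each stochastic graph), the algorithm has asymptotic competitive ratio $1/e$ against the committal benchmark, that is, $$\liminf_{\mathrm{OPT}(G)\to\infty}\frac{\mathbb E[\mathrm{val}(\mathcal A(G))]}{\mathrm{OPT}(G)}=\frac1e ,$$ where the limit inferior is over all stochastic graphs $G$. -/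

import Mathlib

/-- A stochastic bipartite graph with edge set `U × V`: `U` is the set of offline vertices, `V` the
set of online vertices, `p u v` the probability that the edge `(u, v)` is active, `w u v` its weight,
and `patience v` the maximum number of edges at `v` that may be probed. -/
structure StochasticGraph where
  U : Type
  V : Type
  [fintypeU : Fintype U]
  [decidableEqU : DecidableEq U]
  [fintypeV : Fintype V]
  [decidableEqV : DecidableEq V]
  p : U → V → ℝ
  p_nonneg : ∀ u v, 0 ≤ p u v
  p_le_one : ∀ u v, p u v ≤ 1
  w : U → V → ℝ
  patience : V → ℕ

namespace StochasticGraph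

attribute [instance] fintypeU decidableEqU fintypeV decidableEqV

/-- The induced stochastic graph on all offline vertices and the online vertices in `S`. -/
def induce (G : StochasticGraph) (S : Finset G.V) : StochasticGraph where
  U := G.U
  V := {v : G.V // v ∈ S}
  p u v := G.p u v.1
  p_nonneg u v := G.p_nonneg u v.1
  p_le_one u v := G.p_le_one u v.1
  w u v := G.w u v.1
  patience v := G.patience v.1

/-- The total weight of a set of edges. -/
def weight (G : StochasticGraph) (M : Finset (G.U × G.V)) : ℝ :=
  ∑ e ∈ M, G.w e.1 e.2

/-- The probability of the joint edge state `st`; the states are independent Bernoulli variables. -/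
def stateProb (G : StochasticGraph) (st : G.U → G.V → Bool) : ℝ :=
  ∏ u, ∏ v, if st u v then G.p u v else 1 - G.p u v

lemma stateProb_nonneg (G : StochasticGraph) (st : G.U → G.V → Bool) : 0 ≤ G.stateProb st := by
  refine Finset.prod_nonneg fun u _ => Finset.prod_nonneg fun v _ => ?_
  split_ifs
  · exact G.p_nonneg u v
  · linarith [G.p_le_one u v]

/-! ### The committal benchmark -/

/-- An adaptive (offline) probing strategy: either halt, or probe the edge `(u, v)` and continue in
a way that depends on whether that edge turned out to be active. -/
inductive Strategy (U V : Type) : Type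
  | halt : Strategy U V
  | probe (u : U) (v : V) (next : Bool → Strategy U V) : Strategy U V

/-- The strategy makes at most `ℓ v` probes to edges at `v`, for every `v`, along every branch. -/
def Strategy.RespectsPatience {U V : Type} [DecidableEq V] : Strategy U V → (V → ℕ) → Prop
  | .halt, _ => True
  | .probe _ v next, ℓ => 0 < ℓ v ∧ ∀ b, (next b).RespectsPatience (Function.update ℓ v (ℓ v - 1))

/-- The matching after an edge `(u, v)` is probed and revealed to have state `active`. The edge is
irrevocably added if it is active and both of its endpoints are unmatched. -/
def commit {U V : Type} [DecidableEq U] [DecidableEq V]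
    (M : Finset (U × V)) (u : U) (v : V) (active : Bool) : Finset (U × V) :=
  if active = true ∧ (∀ e ∈ M, e.1 ≠ u ∧ e.2 ≠ v) then insert (u, v) M else M

/-- The matching obtained by running the strategy on the edge states `st`, from the matching `M`. -/
def Strategy.run {U V : Type} [DecidableEq U] [DecidableEq V] (st : U → V → Bool) :
    Strategy U V → Finset (U × V) → Finset (U × V)
  | .halt, M => M
  | .probe u v next, M => (next (st u v)).run st (commit M u v (st u v))

/-- The expected weight of the matching built by a strategy. -/
def strategyValue (G : StochasticGraph) (A : Strategy G.U G.V) : ℝ :=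
  ∑ st : G.U → G.V → Bool, G.stateProb st * G.weight (A.run st ∅)

/-- The value `OPT(G)` of the committal benchmark: the largest expected weight attained by an
adaptive probing strategy that respects commitment and the patience values. -/
noncomputable def OPT (G : StochasticGraph) : ℝ :=
  sSup {r | ∃ A : Strategy G.U G.V, A.RespectsPatience G.patience ∧ r = G.strategyValue A}

/-- The supremum defining `OPT` is over a set of reals that is bounded above (and contains the value
of `Strategy.halt`). -/
lemma bddAbove_strategyValue (G : StochasticGraph) :
    BddAbove {r | ∃ A : Strategy G.U G.V, A.RespectsPatience G.patience ∧ r = G.strategyValue A} := by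
  refine ⟨∑ st : G.U → G.V → Bool, G.stateProb st * ∑ e : G.U × G.V, |G.w e.1 e.2|, ?_⟩
  rintro r ⟨A, -, rfl⟩
  refine Finset.sum_le_sum fun st _ => mul_le_mul_of_nonneg_left ?_ (G.stateProb_nonneg st)
  exact (Finset.sum_le_sum fun e _ => le_abs_self _).trans
    (Finset.sum_le_sum_of_subset_of_nonneg (Finset.subset_univ _) fun _ _ _ => abs_nonneg _)

/-! ### The linear program -/

/-- The nonempty tuples of pairwise distinct elements of `U` of length at most `ℓ`. -/
abbrev ProbeTuple (U : Type) (ℓ : ℕ) : Type :=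
  {l : List U // l ≠ [] ∧ l.Nodup ∧ l.length ≤ ℓ}

noncomputable instance (U : Type) [Fintype U] [DecidableEq U] (ℓ : ℕ) : Fintype (ProbeTuple U ℓ) :=
  Fintype.ofInjective (fun l : ProbeTuple U ℓ => (⟨l.1, l.2.2.1⟩ : {l : List U // l.Nodup}))
    fun _ _ h => Subtype.ext (congrArg (fun z : {l : List U // l.Nodup} => z.1) h)

/-- The probability that the entry of index `i` (counted from zero) is the first active one when the
edges from `v` to the entries of `l` are revealed in order. -/
def g (G : StochasticGraph) (v : G.V) (l : List G.U) (i : Fin l.length) : ℝ :=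
  G.p (l.get i) v * ((l.take i).map fun u => 1 - G.p u v).prod

/-- Values for the variables of the linear program. -/
abbrev LPVars (G : StochasticGraph) : Type :=
  (v : G.V) → ProbeTuple G.U (G.patience v) → ℝ

noncomputable def lpObjective (G : StochasticGraph) (x : G.LPVars) : ℝ :=
  ∑ v, ∑ l : ProbeTuple G.U (G.patience v),
    (∑ i : Fin l.1.length, G.w (l.1.get i) v * G.g v l.1 i) * x v l

structure LPFeasible (G : StochasticGraph) (x : G.LPVars) : Prop where
  offline : ∀ u : G.U, ∑ v, ∑ l : ProbeTuple G.U (G.patience v),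
    ∑ i : Fin l.1.length, (if l.1.get i = u then G.g v l.1 i * x v l else 0) ≤ 1
  online : ∀ v, ∑ l, x v l ≤ 1
  nonneg : ∀ v l, 0 ≤ x v l

/-- `x` is an optimum solution of the linear program for `G`. -/
structure IsLPOptimum (G : StochasticGraph) (x : G.LPVars) : Prop where
  feasible : G.LPFeasible x
  optimal : ∀ y : G.LPVars, G.LPFeasible y → G.lpObjective y ≤ G.lpObjective x

/-- The linear program always has an optimum solution. -/
theorem exists_isLPOptimum (G : StochasticGraph) : ∃ x : G.LPVars, G.IsLPOptimum x := by
  have hcl : IsClosed {x : G.LPVars | G.LPFeasible x} := by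
    have : {x : G.LPVars | G.LPFeasible x} =
        (⋂ u : G.U, {x : G.LPVars | ∑ v, ∑ l : ProbeTuple G.U (G.patience v),
          ∑ i : Fin l.1.length, (if l.1.get i = u then G.g v l.1 i * x v l else 0) ≤ 1}) ∩
        ((⋂ v, {x : G.LPVars | ∑ l, x v l ≤ 1}) ∩ ⋂ v, ⋂ l, {x : G.LPVars | 0 ≤ x v l}) := by
      ext x
      simp only [Set.mem_ofPred_eq, Set.mem_inter_iff, Set.mem_iInter]
      exact ⟨fun h => ⟨h.1, h.2, h.3⟩, fun h => ⟨h.1, h.2.1, h.2.2⟩⟩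
    rw [this]
    refine (isClosed_iInter fun u => ?_).inter ((isClosed_iInter fun v => ?_).inter
      (isClosed_iInter fun v => isClosed_iInter fun l => ?_))
    · refine isClosed_le ?_ continuous_const
      refine continuous_finsetSum _ fun v _ => continuous_finsetSum _ fun l _ =>
        continuous_finsetSum _ fun i _ => ?_
      split_ifs
      · fun_prop
      · exact continuous_const
    · exact isClosed_le (by fun_prop) continuous_const
    · exact isClosed_le continuous_const (by fun_prop)
  have hcpt : IsCompact {x : G.LPVars | G.LPFeasible x} := by
    refine (isCompact_Icc (a := (0 : G.LPVars)) (b := 1)).of_isClosed_subset hcl fun x hx => ?_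
    refine ⟨fun v l => hx.nonneg v l, fun v l => ?_⟩
    exact (Finset.single_le_sum (f := x v) (fun l _ => hx.nonneg v l)
      (Finset.mem_univ l)).trans (hx.online v)
  have hne : {x : G.LPVars | G.LPFeasible x}.Nonempty :=
    ⟨fun _ _ => 0, ⟨fun u => by simp, fun v => by simp, fun v l => le_rfl⟩⟩
  have hcont : ContinuousOn G.lpObjective {x : G.LPVars | G.LPFeasible x} := by
    unfold lpObjective
    fun_prop
  obtain ⟨x, hx, hmax⟩ := hcpt.exists_isMaxOn hne hcont
  exact ⟨x, hx, fun y hy => hmax hy⟩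

/-! ### The online algorithm -/

/-- The number `n` of online vertices. -/
def numOnline (G : StochasticGraph) : ℕ := Fintype.card G.V

/-- An arrival order of the online vertices; `σ t` is the arrival number `t + 1`. -/
abbrev ArrivalOrder (G : StochasticGraph) : Type := Fin G.numOnline ≃ G.V

/-- The set of the vertices which arrived up to and including `σ t`. -/
def arrived (G : StochasticGraph) (σ : G.ArrivalOrder) (t : Fin G.numOnline) : Finset G.V :=
  (Finset.univ.filter fun s => s ≤ t).image σ

lemma mem_arrived (G : StochasticGraph) (σ : G.ArrivalOrder) (t : Fin G.numOnline) :
    σ t ∈ G.arrived σ t :=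
  Finset.mem_image_of_mem σ (by simp)

/-- A rule which selects values for the variables of the linear program of every stochastic graph. -/
abbrev LPRule : Type 1 := (H : StochasticGraph) → H.LPVars

/-- The variables `x_{v_t}` of the arriving vertex `v_t = σ t`, in the solution selected for the
graph induced by the vertices which have arrived so far. -/
def arrivalVars (G : StochasticGraph) (solve : LPRule) (σ : G.ArrivalOrder) (t : Fin G.numOnline) :
    ProbeTuple G.U (G.patience (σ t)) → ℝ :=
  solve (G.induce (G.arrived σ t)) ⟨σ t, G.mem_arrived σ t⟩

/-- The random choice of `VertexProbe`: the tuple `l` has probability `x l`, and with the remaining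
probability the vertex is passed (`none`). -/
noncomputable def drawProb {U : Type} [Fintype U] [DecidableEq U] {ℓ : ℕ}
    (x : ProbeTuple U ℓ → ℝ) : Option (ProbeTuple U ℓ) → ℝ
  | none => 1 - ∑ l, x l
  | some l => x l

/-- The result of `VertexProbe` at a vertex after its random choice, where `st u` is the state of the
edge to `u`: the edges to the entries of the drawn tuple are probed in order up to the first active
one, and its offline endpoint is returned, if there is one. -/
def vertexProbe {U : Type} {ℓ : ℕ} (st : U → Bool) : Option (ProbeTuple U ℓ) → Option U
  | none => none
  | some l => l.1.find? st

/-- Match the online vertex `v` to the vertex returned by `VertexProbe` if that one is unmatched. -/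
def addEdge {U V : Type} [DecidableEq U] [DecidableEq V] (M : Finset (U × V)) (v : V) :
    Option U → Finset (U × V)
  | none => M
  | some u => if ∀ e ∈ M, e.1 ≠ u then insert (u, v) M else M

/-- The outcomes of the random choices of `VertexProbe`, one for each arrival. -/
abbrev Draws (G : StochasticGraph) (σ : G.ArrivalOrder) : Type :=
  (t : Fin G.numOnline) → Option (ProbeTuple G.U (G.patience (σ t)))

/-- The matching returned by the algorithm with parameter `α`, given the arrival order `σ`, the edge
states `st` and the random choices `c` (those of the arrivals passed on are not used). -/
noncomputable def algMatching (G : StochasticGraph) (α : ℝ) (σ : G.ArrivalOrder)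
    (st : G.U → G.V → Bool) (c : G.Draws σ) : Finset (G.U × G.V) :=
  (List.finRange G.numOnline).foldl
    (fun M (t : Fin G.numOnline) =>
      if ((t.val + 1 : ℕ) : ℝ) < G.numOnline * α then M
      else addEdge M (σ t) (vertexProbe (fun u => st u (σ t)) (c t)))
    ∅

/-- The expected weight of the matching returned by the algorithm with parameter `α`, where the
solution of each linear program is selected by `solve`. The arrival order is uniformly random; the
edge states are independent of it, and given the order the random choices of `VertexProbe` are
independent of each other and of the edge states. -/
noncomputable def algValue (α : ℝ) (solve : LPRule) (G : StochasticGraph) : ℝ :=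
  (∑ σ : G.ArrivalOrder, ∑ st : G.U → G.V → Bool, ∑ c : G.Draws σ,
      G.stateProb st * (∏ t, drawProb (G.arrivalVars solve σ t) (c t)) *
        G.weight (G.algMatching α σ st c)) /
    Fintype.card G.ArrivalOrder

/-- The asymptotic competitive ratio against the committal benchmark of an online algorithm whose
expected value on `G` is `val G`: the limit inferior of `val G / OPT G` as `OPT G → ∞`, over all
stochastic graphs. -/
noncomputable def asymptoticCompetitiveRatio (val : StochasticGraph → ℝ) : EReal :=
  Filter.liminf (fun G : StochasticGraph => ((val G / G.OPT : ℝ) : EReal))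
    (Filter.comap OPT Filter.atTop)

end StochasticGraph

/-! Everything passes through LP-new and the classical secretary rule; arrivals are indexed from
zero below.

The program relaxes the committal benchmark. Fix an online vertex `v`. As long as `v` is unmatched,
every probe at `v` has failed or has hit an offline vertex already taken, and the first other
success settles `v` for good. So the probabilities with which an adaptive strategy matches `v` to
the various `u` form a convex combination of the vectors `firstActive` of fixed tuples
(`marginal_mem_probePolytope`), and `OPT_le_lpObjective` follows.

For a fixed arrival order, edge states and draws at different arrivals are independent. If
`VertexProbe` at arrival `s` returns `u` with probability `q s`, then, without skipping, `u` is
matched at `t` with probability `q t * ∏ (1 - q s)` over `s < t`; skipped arrivals contribute `q s =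
0`. Now reveal the order backwards: given the set of the first `s + 1` arrivals and everything
later, the last of them is uniform (`sum_last_arrival`), so the offline constraint makes `q s` at
most `1 / (s + 1)` on average. Peeling off one factor at a time (`sum_mul_prod_one_sub`) bounds the
chance that `u` is still free by the survival product of the secretary problem. The weight proposed
at arrival `t` is on average at least `1 / n` of the program's value, because the optimum for `G`
restricted to the arrived vertices is feasible for them. Altogether the algorithm earns at least
`secretaryProb` times the program's value, and `secretaryProb n (1 / e) ≥ 1 / e` for every `n ≥ 1`,
not just in the limit.

For the converse, take one offline vertex and only active edges, one of huge weight `B` and the rest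
of weight `1`. Positive weights force every optimum to saturate the offline constraint, so the
averages above are equalities whichever optimum is chosen, and the ratio is at most `secretaryProb n
(1 / e) + n / B`, which tends to `1 / e`. -/

/-! ### Products of independent Bernoulli variables -/

/-- The expectation of `f` under the product of the Bernoulli distributions with parameters `p i`. -/
def bernExp {ι : Type*} [Fintype ι] [DecidableEq ι] (p : ι → ℝ) (f : (ι → Bool) → ℝ) : ℝ :=
  ∑ s : ι → Bool, (∏ i, if s i then p i else 1 - p i) * f s

section bernExp

variable {ι : Type*} [Fintype ι] [DecidableEq ι]

/-- Conditioning on one coordinate. It overwrites a parameter by `1` or `0` instead of removing it,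
so the index type stays fixed and a repeated probe of the same edge is simply deterministic. -/
lemma bernExp_split (p : ι → ℝ) (f : (ι → Bool) → ℝ) (a : ι) :
    bernExp p f = p a * bernExp (Function.update p a 1) f +
      (1 - p a) * bernExp (Function.update p a 0) f := by
  unfold bernExp
  rw [Finset.mul_sum, Finset.mul_sum, ← Finset.sum_add_distrib]
  refine Finset.sum_congr rfl fun s _ => ?_
  have key : ∀ c : ℝ, (∏ i, if s i then Function.update p a c i else 1 - Function.update p a c i) =
      (if s a then c else 1 - c) * ∏ i ∈ Finset.univ.erase a, if s i then p i else 1 - p i := by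
    intro c
    rw [← Finset.mul_prod_erase _ _ (Finset.mem_univ a)]
    congr 1
    · simp
    · refine Finset.prod_congr rfl fun i hi => ?_
      rw [Function.update_of_ne (Finset.ne_of_mem_erase hi)]
  rw [key, key, ← Finset.mul_prod_erase _ _ (Finset.mem_univ a)]
  cases s a <;> simp <;> ring

lemma bernExp_update_congr (p : ι → ℝ) {f g : (ι → Bool) → ℝ} (a : ι) (b : Bool)
    (h : ∀ s, s a = b → f s = g s) :
    bernExp (Function.update p a (if b then 1 else 0)) f =
      bernExp (Function.update p a (if b then 1 else 0)) g := by
  unfold bernExp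
  refine Finset.sum_congr rfl fun s _ => ?_
  by_cases hs : s a = b
  · rw [h s hs]
  · rw [Finset.prod_eq_zero (Finset.mem_univ a), zero_mul, zero_mul]
    cases b <;> simp_all

lemma bernExp_one (p : ι → ℝ) : bernExp p (fun _ => 1) = 1 := by
  have h := Finset.prod_univ_sum (fun _ : ι => (Finset.univ : Finset Bool))
    (fun i b => if b then p i else 1 - p i)
  simp only [Fintype.piFinset_univ] at h
  simp [bernExp, ← h]

lemma bernExp_const (p : ι → ℝ) (c : ℝ) : bernExp p (fun _ => c) = c := by
  have h := bernExp_one p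
  unfold bernExp at h ⊢
  rw [← Finset.sum_mul]
  simp only [mul_one] at h
  rw [h, one_mul]

lemma bernExp_mono {p : ι → ℝ} (h0 : ∀ i, 0 ≤ p i) (h1 : ∀ i, p i ≤ 1) {f g : (ι → Bool) → ℝ}
    (h : ∀ s, f s ≤ g s) : bernExp p f ≤ bernExp p g := by
  refine Finset.sum_le_sum fun s _ => mul_le_mul_of_nonneg_left (h s) ?_
  refine Finset.prod_nonneg fun i _ => ?_
  split_ifs
  · exact h0 i
  · linarith [h1 i]

end bernExp

/-! ### Marginals of probing a single online vertex -/

/-- `firstActive p l u` is the probability that `u` is the first active entry of `l`. -/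
def firstActive {U : Type} [DecidableEq U] (p : U → ℝ) : List U → U → ℝ
  | [] => 0
  | a :: l => Pi.single a (p a) + (1 - p a) • firstActive p l

/-- The convex hull of the marginals attained by probing the entries of a tuple over `S` of length at
most `ℓ` up to the first active one. -/
def probePolytope {U : Type} [DecidableEq U] (p : U → ℝ) (S : Set U) (ℓ : ℕ) : Set (U → ℝ) :=
  convexHull ℝ {y | ∃ l : List U, l.Nodup ∧ (∀ u ∈ l, u ∈ S) ∧ l.length ≤ ℓ ∧ y = firstActive p l}

section polytope

variable {U : Type} [DecidableEq U] {p : U → ℝ} {S : Set U} {ℓ : ℕ}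

lemma convex_probePolytope : Convex ℝ (probePolytope p S ℓ) := convex_convexHull ℝ _

lemma firstActive_mem {l : List U} (h : l.Nodup) (hS : ∀ u ∈ l, u ∈ S) (hl : l.length ≤ ℓ) :
    firstActive p l ∈ probePolytope p S ℓ :=
  subset_convexHull ℝ _ ⟨l, h, hS, hl, rfl⟩

lemma zero_mem_probePolytope : (0 : U → ℝ) ∈ probePolytope p S ℓ :=
  firstActive_mem (l := []) (by simp) (by simp) (by simp)

lemma probePolytope_mono {S' : Set U} {ℓ' : ℕ} (hS : S ⊆ S') (hℓ : ℓ ≤ ℓ') :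
    probePolytope p S ℓ ⊆ probePolytope p S' ℓ' := by
  refine convexHull_mono ?_
  rintro y ⟨l, h1, h2, h3, rfl⟩
  exact ⟨l, h1, fun u hu => hS (h2 u hu), h3.trans hℓ, rfl⟩

lemma smul_mem_probePolytope {y : U → ℝ} (hy : y ∈ probePolytope p S ℓ) {c : ℝ} (h0 : 0 ≤ c)
    (h1 : c ≤ 1) : c • y ∈ probePolytope p S ℓ := by
  have := convex_probePolytope hy zero_mem_probePolytope h0 (sub_nonneg.2 h1) (by ring)
  simpa using this

/-- Prepending `a` to every tuple acts on the marginals as an affine map, which carries convex hulls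
into convex hulls. -/
lemma probe_mem_probePolytope {y : U → ℝ} {a : U} (ha : a ∈ S) (hℓ : 0 < ℓ)
    (hy : y ∈ probePolytope p (S \ {a}) (ℓ - 1)) :
    Pi.single a (p a) + (1 - p a) • y ∈ probePolytope p S ℓ := by
  have hc : Convex ℝ {y : U → ℝ | Pi.single a (p a) + (1 - p a) • y ∈ probePolytope p S ℓ} := by
    intro y hy z hz c d hc hd hcd
    have := convex_probePolytope hy hz hc hd hcd
    have e : c • (Pi.single a (p a) + (1 - p a) • y) + d • (Pi.single a (p a) + (1 - p a) • z) =
        (Pi.single a (p a) + (1 - p a) • (c • y + d • z) : U → ℝ) := by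
      have hd' : d = 1 - c := by linarith
      subst hd'
      module
    rw [e] at this
    exact this
  refine convexHull_min ?_ hc hy
  rintro _ ⟨l, h1, h2, h3, rfl⟩
  refine firstActive_mem (l := a :: l) ?_ ?_ ?_
  · exact List.nodup_cons.2 ⟨fun h => (h2 a h).2 rfl, h1⟩
  · intro u hu
    rcases List.mem_cons.1 hu with rfl | h
    · exact ha
    · exact (h2 u h).1
  · simp only [List.length_cons]; omega

lemma firstActive_nonneg (h0 : ∀ u, 0 ≤ p u) (h1 : ∀ u, p u ≤ 1) (l : List U) (u : U) :
    0 ≤ firstActive p l u := by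
  induction l with
  | nil => simp [firstActive]
  | cons a l ih =>
    simp only [firstActive, Pi.add_apply, Pi.smul_apply, smul_eq_mul]
    refine add_nonneg ?_ (mul_nonneg (by linarith [h1 a]) ih)
    by_cases h : u = a
    · subst h; simpa using h0 u
    · simp [h]

/-- Zeroing a coordinate stays in the polytope. -/
lemma update_zero_mem_probePolytope (h0 : ∀ u, 0 ≤ p u) (h1 : ∀ u, p u ≤ 1) {y : U → ℝ}
    (hy : y ∈ probePolytope p S ℓ) (u : U) : Function.update y u 0 ∈ probePolytope p S ℓ := by
  have hc : Convex ℝ {y : U → ℝ | Function.update y u 0 ∈ probePolytope p S ℓ} := by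
    intro y hy z hz c d hc hd hcd
    have := convex_probePolytope hy hz hc hd hcd
    have e : c • Function.update y u 0 + d • Function.update z u 0 =
        Function.update (c • y + d • z) u 0 := by
      ext i
      by_cases hi : i = u
      · subst hi; simp
      · simp [hi]
    rw [e] at this
    exact this
  refine convexHull_min ?_ hc hy
  rintro _ ⟨l, h1', h2, h3, rfl⟩
  show Function.update (firstActive p l) u 0 ∈ probePolytope p S ℓ
  clear hc hy
  induction l generalizing S ℓ with
  | nil =>
    have : Function.update (firstActive p []) u 0 = 0 := by
      ext i; by_cases hi : i = u <;> simp [firstActive, hi]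
    rw [this]; exact zero_mem_probePolytope
  | cons a l ih =>
    have hl : 0 < ℓ := lt_of_lt_of_le (by simp) h3
    have ih' := ih (S := S \ {a}) (ℓ := ℓ - 1) (List.nodup_cons.1 h1').2
      (fun v hv => ⟨h2 v (List.mem_cons_of_mem _ hv), fun h => (List.nodup_cons.1 h1').1 (h ▸ hv)⟩)
      (by simp only [List.length_cons] at h3; omega)
    -- Deleting `u` from the tuple would inflate the marginals of the later entries; the lost factor
    -- `1 - p u` is put back by mixing with the empty tuple.
    by_cases hau : a = u
    · have : Function.update (firstActive p (a :: l)) u 0 =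
          (1 - p a) • Function.update (firstActive p l) u 0 := by
        ext i; by_cases hi : i = u
        · subst hi; simp
        · simp [firstActive, hi, hau]
      rw [this]
      exact smul_mem_probePolytope (probePolytope_mono Set.sdiff_subset (Nat.sub_le _ _) ih')
        (by linarith [h1 a]) (by linarith [h0 a])
    · have : Function.update (firstActive p (a :: l)) u 0 =
          Pi.single a (p a) + (1 - p a) • Function.update (firstActive p l) u 0 := by
        ext i; by_cases hi : i = u
        · subst hi; simp [Ne.symm hau]
        · simp [firstActive, hi]
      rw [this]
      exact probe_mem_probePolytope (h2 a (by simp)) hl ih'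

end polytope

/-! ### Marginals of an adaptive probing strategy -/

namespace StochasticGraph

section strategy

variable {U V : Type} [DecidableEq U] [DecidableEq V]

lemma subset_commit (M : Finset (U × V)) (u : U) (v : V) (b : Bool) : M ⊆ commit M u v b := by
  unfold commit
  split_ifs
  · exact Finset.subset_insert _ _
  · exact subset_rfl

/-- Commitment: once `v` is matched, no later probe can add an edge at `v`. -/
lemma mem_run_iff_of_matched (st : U → V → Bool) (A : Strategy U V) (M : Finset (U × V)) (u : U)
    (v : V) (h : ∃ e ∈ M, e.2 = v) : (u, v) ∈ A.run st M ↔ (u, v) ∈ M := by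
  induction A generalizing M with
  | halt => rfl
  | probe a b next ih =>
    obtain ⟨e, he, hev⟩ := h
    rw [Strategy.run, ih _ _ ⟨e, subset_commit _ _ _ _ he, hev⟩]
    unfold commit
    split_ifs with hc
    · have : b ≠ v := fun hb => (hc.2 e he).2 (hev.trans hb.symm)
      simp [this.symm]
    · rfl

lemma injOn_fst_run (st : U → V → Bool) (A : Strategy U V) (M : Finset (U × V))
    (h : Set.InjOn Prod.fst (M : Set (U × V))) :
    Set.InjOn Prod.fst (A.run st M : Set (U × V)) := by
  induction A generalizing M with
  | halt => exact h
  | probe a b next ih =>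
    rw [Strategy.run]
    refine ih _ _ ?_
    unfold commit
    split_ifs with hc
    · rw [Finset.coe_insert]
      refine (Set.injOn_insert fun hm => (hc.2 _ hm).1 rfl).2 ⟨h, ?_⟩
      rintro ⟨e, he, hea⟩
      exact (hc.2 e he).1 hea
    · exact h

variable [Fintype U] [Fintype V]

/-- The probability that the strategy `A`, started from `M`, matches `v` to `u`, as a function of
`u`, when the edges are independently active with probabilities `q`. -/
def marginal (q : U × V → ℝ) (A : Strategy U V) (M : Finset (U × V)) (v : V) (u : U) : ℝ :=
  bernExp q fun s => if (u, v) ∈ A.run (fun a b => s (a, b)) M then 1 else 0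

lemma marginal_probe (q : U × V → ℝ) (a : U) (b : V) (next : Bool → Strategy U V)
    (M : Finset (U × V)) (v : V) :
    marginal q (.probe a b next) M v =
      q (a, b) • marginal (Function.update q (a, b) 1) (next true) (commit M a b true) v +
      (1 - q (a, b)) • marginal (Function.update q (a, b) 0) (next false) M v := by
  ext u
  unfold marginal
  rw [bernExp_split q _ (a, b)]
  simp only [Pi.add_apply, Pi.smul_apply, smul_eq_mul]
  congr 2
  · have := bernExp_update_congr q (a, b) true
      (f := fun s => if (u, v) ∈ (Strategy.probe a b next).run (fun a b => s (a, b)) M then 1 else 0)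
      (g := fun s => if (u, v) ∈ (next true).run (fun a b => s (a, b)) (commit M a b true)
        then 1 else 0) (fun s hs => by rw [Strategy.run, hs])
    simpa using this
  · have := bernExp_update_congr q (a, b) false
      (f := fun s => if (u, v) ∈ (Strategy.probe a b next).run (fun a b => s (a, b)) M then 1 else 0)
      (g := fun s => if (u, v) ∈ (next false).run (fun a b => s (a, b)) M
        then 1 else 0) (fun s hs => by rw [Strategy.run, hs]; simp [commit])
    simpa using this

lemma marginal_of_matched (q : U × V → ℝ) (A : Strategy U V) (M : Finset (U × V)) (v : V)
    (h : ∃ e ∈ M, e.2 = v) : marginal q A M v = fun u => if (u, v) ∈ M then 1 else 0 := by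
  ext u
  unfold marginal
  simp only [mem_run_iff_of_matched _ A M u v h]
  exact bernExp_const q _

/-- The marginals at `v` of an adaptive strategy lie in the polytope of non-adaptive ones. Here `S`
contains the offline vertices not yet probed from `v`, and `q` records the outcomes of the probes made
so far. -/
lemma marginal_mem_probePolytope (p : U → ℝ) (A : Strategy U V) (v : V) (q : U × V → ℝ)
    (hq0 : ∀ e, 0 ≤ q e) (hq1 : ∀ e, q e ≤ 1) (ℓ : V → ℕ) (hA : A.RespectsPatience ℓ)
    (M : Finset (U × V)) (hM : ∀ e ∈ M, e.2 ≠ v) (S : Set U) (hS : ∀ u ∈ S, q (u, v) = p u)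
    (hS' : ∀ u ∉ S, q (u, v) = 0 ∨ ∃ e ∈ M, e.1 = u) :
    marginal q A M v ∈ probePolytope p S (ℓ v) := by
  induction A generalizing q ℓ M S with
  | halt =>
    have : marginal q (.halt : Strategy U V) M v = 0 := by
      ext u
      have : (u, v) ∉ M := fun h => hM _ h rfl
      simp only [marginal, Strategy.run, this, if_false]
      exact bernExp_const q 0
    rw [this]
    exact zero_mem_probePolytope
  | probe a b next ih =>
    obtain ⟨hℓ, hnext⟩ := hA
    have hu1 : ∀ c : ℝ, 0 ≤ c → ∀ e, 0 ≤ Function.update q (a, b) c e := fun c hc e => by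
      by_cases h : e = (a, b)
      · subst h; simpa
      · simpa [h] using hq0 e
    have hu2 : ∀ c : ℝ, c ≤ 1 → ∀ e, Function.update q (a, b) c e ≤ 1 := fun c hc e => by
      by_cases h : e = (a, b)
      · subst h; simpa
      · simpa [h] using hq1 e
    have comb : ∀ {T : Set U} {k : ℕ} {y z : U → ℝ}, y ∈ probePolytope p T k →
        z ∈ probePolytope p T k →
        q (a, b) • y + (1 - q (a, b)) • z ∈ probePolytope p T k := fun hy hz =>
      convex_probePolytope hy hz (hq0 _) (sub_nonneg.2 (hq1 _)) (by ring)
    rw [marginal_probe]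
    by_cases hb : b = v
    · subst hb
      have hp : Function.update ℓ b (ℓ b - 1) b = ℓ b - 1 := by simp
      -- Three kinds of probe at `v`. If `a` is already matched, the probe changes nothing and `a`
      -- may be discarded from `S`. If `a` is free and in `S`, success settles `v` and failure
      -- leaves a strategy over `S \ {a}`. If `a` is free and outside `S`, its edge is known to be
      -- inactive, since an earlier success would have matched `a`.
      by_cases haM : ∃ e ∈ M, e.1 = a
      · have hcm : commit M a b true = M := by
          obtain ⟨e, he, hea⟩ := haM
          unfold commit
          rw [if_neg]
          exact fun h => (h.2 e he).1 hea
        rw [hcm]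
        have main : ∀ β : Bool, ∀ c : ℝ, 0 ≤ c → c ≤ 1 →
            marginal (Function.update q (a, b) c) (next β) M b ∈
              probePolytope p (S \ {a}) (ℓ b - 1) := by
          intro β c hc0 hc1
          rw [← hp]
          refine ih β _ (hu1 c hc0) (hu2 c hc1) _ (hnext β) M hM _ ?_ ?_
          · rintro u ⟨hu, hua⟩
            rw [Function.update_of_ne (by simpa using hua)]
            exact hS u hu
          · intro u hu
            by_cases hua : u = a
            · subst hua; exact Or.inr haM
            · rw [Function.update_of_ne (by simpa using hua)]
              exact hS' u fun h => hu ⟨h, hua⟩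
        exact probePolytope_mono Set.sdiff_subset (Nat.sub_le _ _)
          (comb (main true 1 zero_le_one le_rfl) (main false 0 le_rfl zero_le_one))
      · by_cases haS : a ∈ S
        · have hcm : commit M a b true = insert (a, b) M := by
            unfold commit
            rw [if_pos]
            exact ⟨rfl, fun e he => ⟨fun h => haM ⟨e, he, h⟩, hM e he⟩⟩
          rw [hcm, marginal_of_matched _ _ _ _ ⟨(a, b), by simp, rfl⟩]
          have e1 : q (a, b) • (fun u => if (u, b) ∈ insert (a, b) M then (1 : ℝ) else 0) =
              Pi.single a (p a) := by
            ext u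
            have : (u, b) ∉ M := fun h => hM _ h rfl
            by_cases hua : u = a
            · subst hua; simp [hS _ haS]
            · simp [this, hua]
          rw [e1, hS a haS]
          refine probe_mem_probePolytope haS hℓ ?_
          rw [← hp]
          refine ih false _ (hu1 0 le_rfl) (hu2 0 zero_le_one) _ (hnext false) M hM _ ?_ ?_
          · rintro u ⟨hu, hua⟩
            rw [Function.update_of_ne (by simpa using hua)]
            exact hS u hu
          · intro u hu
            by_cases hua : u = a
            · subst hua; exact Or.inl (by simp)
            · rw [Function.update_of_ne (by simpa using hua)]
              exact hS' u fun h => hu ⟨h, hua⟩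
        · have hq : q (a, b) = 0 := (hS' a haS).resolve_right haM
          rw [hq, zero_smul, sub_zero, one_smul, zero_add]
          refine probePolytope_mono subset_rfl (Nat.sub_le (ℓ b) 1) ?_
          rw [← hp]
          refine ih false _ (hu1 0 le_rfl) (hu2 0 zero_le_one) _ (hnext false) M hM _ ?_ ?_
          · intro u hu
            have hua : u ≠ a := fun h => haS (h ▸ hu)
            rw [Function.update_of_ne (by simpa using hua)]
            exact hS u hu
          · intro u hu
            by_cases hua : u = a
            · subst hua; exact Or.inl (by simp)
            · rw [Function.update_of_ne (by simpa using hua)]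
              exact hS' u hu
    -- A probe at another online vertex leaves the patience of `v` and the states of its edges
    -- alone, so both branches stay in the same polytope and are averaged by convexity.
    · have hp : Function.update ℓ b (ℓ b - 1) v = ℓ v := by
        rw [Function.update_of_ne (Ne.symm hb)]
      have main : ∀ β : Bool, ∀ c : ℝ, 0 ≤ c → c ≤ 1 → ∀ M' : Finset (U × V), M ⊆ M' →
          (∀ e ∈ M', e.2 ≠ v) → marginal (Function.update q (a, b) c) (next β) M' v ∈
            probePolytope p S (ℓ v) := by
        intro β c hc0 hc1 M' hMM hM'
        rw [← hp]
        have hne : ∀ u, Function.update q (a, b) c (u, v) = q (u, v) := fun u =>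
          Function.update_of_ne (by simp [Ne.symm hb]) _ _
        refine ih β _ (hu1 c hc0) (hu2 c hc1) _ (hnext β) M' hM' _ ?_ ?_
        · intro u hu
          rw [hne]; exact hS u hu
        · intro u hu
          rw [hne]
          exact (hS' u hu).imp_right fun ⟨e, he, h⟩ => ⟨e, hMM he, h⟩
      refine comb (main true 1 zero_le_one le_rfl _ (subset_commit _ _ _ _) ?_)
        (main false 0 le_rfl zero_le_one _ subset_rfl hM)
      intro e he
      unfold commit at he
      split_ifs at he
      · rcases Finset.mem_insert.1 he with rfl | h
        · exact hb
        · exact hM e h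
      · exact hM e he

end strategy

end StochasticGraph

/-! ### The linear program in terms of marginals -/

namespace StochasticGraph

/-- Both sides satisfy the recursion that conditions on the first entry. This replaces sums over
positions in a tuple by sums over offline vertices, so that the program depends on `x` only through
marginals and total masses. -/
lemma sum_mul_g (G : StochasticGraph) (v : G.V) (l : List G.U) (f : G.U → ℝ) :
    ∑ i : Fin l.length, f (l.get i) * G.g v l i = ∑ u, f u * firstActive (G.p · v) l u := by
  induction l with
  | nil => simp [firstActive]
  | cons a l ih =>
    have h1 : ∀ i : Fin l.length, G.g v (a :: l) i.succ = (1 - G.p a v) * G.g v l i := by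
      intro i
      simp only [g, List.get_eq_getElem, Fin.val_succ, List.getElem_cons_succ, List.take_succ_cons,
        List.map_cons, List.prod_cons]
      ring
    have h0 : G.g v (a :: l) (0 : Fin (l.length + 1)) = G.p a v := by simp [g]
    have e := Fin.sum_univ_succ (n := l.length)
      (fun i => f ((a :: l).get i) * G.g v (a :: l) i)
    refine e.trans ?_
    simp only [h0, h1]
    have h2 : ∀ i : Fin l.length, f ((a :: l).get i.succ) * ((1 - G.p a v) * G.g v l i) =
        (1 - G.p a v) * (f (l.get i) * G.g v l i) := by
      intro i
      simp only [List.get_eq_getElem, Fin.val_succ, List.getElem_cons_succ]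
      ring
    simp only [h2]
    rw [← Finset.mul_sum, ih]
    simp only [firstActive, Pi.add_apply, Pi.smul_apply, smul_eq_mul, mul_add,
      Finset.sum_add_distrib]
    congr 1
    · simp [Pi.single_apply]
    · rw [Finset.mul_sum]
      exact Finset.sum_congr rfl fun u _ => by ring

/-- The probability that `VertexProbe` at `v`, run with the values `x v`, returns `u`. -/
noncomputable def lpMarginal (G : StochasticGraph) (x : G.LPVars) (v : G.V) : G.U → ℝ :=
  ∑ l, x v l • firstActive (G.p · v) l.1

lemma lpMarginal_apply (G : StochasticGraph) (x : G.LPVars) (v : G.V) (u : G.U) :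
    G.lpMarginal x v u = ∑ l, x v l * firstActive (G.p · v) l.1 u := by
  simp [lpMarginal, Finset.sum_apply]

lemma lpObjective_eq (G : StochasticGraph) (x : G.LPVars) :
    G.lpObjective x = ∑ v, ∑ u, G.w u v * G.lpMarginal x v u := by
  unfold lpObjective
  refine Finset.sum_congr rfl fun v _ => ?_
  simp only [lpMarginal_apply, Finset.mul_sum]
  rw [Finset.sum_comm]
  refine Finset.sum_congr rfl fun l _ => ?_
  rw [G.sum_mul_g v l.1 (fun u => G.w u v), Finset.sum_mul]
  exact Finset.sum_congr rfl fun u _ => by ring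

lemma sum_offline_eq (G : StochasticGraph) (x : G.LPVars) (v : G.V) (u : G.U) :
    ∑ l : ProbeTuple G.U (G.patience v), ∑ i : Fin l.1.length,
      (if l.1.get i = u then G.g v l.1 i * x v l else 0) = G.lpMarginal x v u := by
  rw [lpMarginal_apply]
  refine Finset.sum_congr rfl fun l _ => ?_
  have h := G.sum_mul_g v l.1 (fun a => if a = u then x v l else 0)
  simp only [ite_mul, zero_mul, Finset.sum_ite_eq', Finset.mem_univ, if_true] at h
  rw [← h]
  exact Finset.sum_congr rfl fun i _ => by rw [mul_comm]

lemma lpFeasible_iff (G : StochasticGraph) (x : G.LPVars) :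
    G.LPFeasible x ↔ (∀ u, ∑ v, G.lpMarginal x v u ≤ 1) ∧ (∀ v, ∑ l, x v l ≤ 1) ∧
      ∀ v l, 0 ≤ x v l := by
  constructor
  · intro h
    refine ⟨fun u => ?_, h.2, h.3⟩
    have := h.1 u
    simpa only [sum_offline_eq] using this
  · rintro ⟨h1, h2, h3⟩
    refine ⟨fun u => ?_, h2, h3⟩
    simpa only [sum_offline_eq] using h1 u

lemma lpMarginal_nonneg (G : StochasticGraph) {x : G.LPVars} (h : ∀ v l, 0 ≤ x v l) (v : G.V)
    (u : G.U) : 0 ≤ G.lpMarginal x v u := by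
  rw [lpMarginal_apply]
  exact Finset.sum_nonneg fun l _ => mul_nonneg (h v l)
    (firstActive_nonneg (fun u => G.p_nonneg u v) (fun u => G.p_le_one u v) _ _)

/-- The polytope of the marginals which can be attained at `v`. -/
abbrev vertexPolytope (G : StochasticGraph) (v : G.V) : Set (G.U → ℝ) :=
  probePolytope (G.p · v) Set.univ (G.patience v)

lemma lpMarginal_mem (G : StochasticGraph) {x : G.LPVars} (hx : G.LPFeasible x) (v : G.V) :
    G.lpMarginal x v ∈ G.vertexPolytope v := by
  have hc := convex_probePolytope (p := (G.p · v)) (S := Set.univ) (ℓ := G.patience v)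
  have := hc.sum_mem (t := (Finset.univ : Finset (Option (ProbeTuple G.U (G.patience v)))))
    (w := drawProb (x v)) (z := fun o => firstActive (G.p · v) (o.elim [] (·.1))) ?_ ?_ ?_
  · simpa [Fintype.sum_option, drawProb, firstActive, lpMarginal] using this
  · rintro (_ | l) _
    · simpa [drawProb] using hx.online v
    · exact hx.nonneg v l
  · simp [Fintype.sum_option, drawProb]
  · rintro (_ | l) _
    · exact zero_mem_probePolytope
    · exact firstActive_mem l.2.2.1 (by simp) l.2.2.2

/-- Converse to `lpMarginal_mem`. The empty tuple generates a vertex of the hull but is not a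
variable of the program; its mass becomes the slack in `∑ l, x l ≤ 1`. -/
lemma exists_of_mem_vertexPolytope (G : StochasticGraph) (v : G.V) {y : G.U → ℝ}
    (hy : y ∈ G.vertexPolytope v) : ∃ x : ProbeTuple G.U (G.patience v) → ℝ,
      (∀ l, 0 ≤ x l) ∧ ∑ l, x l ≤ 1 ∧ y = ∑ l, x l • firstActive (G.p · v) l.1 := by
  have hc : Convex ℝ {y | ∃ x : ProbeTuple G.U (G.patience v) → ℝ,
      (∀ l, 0 ≤ x l) ∧ ∑ l, x l ≤ 1 ∧ y = ∑ l, x l • firstActive (G.p · v) l.1} := by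
    rintro _ ⟨x, hx0, hx1, rfl⟩ _ ⟨z, hz0, hz1, rfl⟩ c d hc hd hcd
    refine ⟨c • x + d • z, fun l => add_nonneg (mul_nonneg hc (hx0 l)) (mul_nonneg hd (hz0 l)),
      ?_, ?_⟩
    · simp only [Pi.add_apply, Pi.smul_apply, smul_eq_mul, Finset.sum_add_distrib,
        ← Finset.mul_sum]
      nlinarith
    · simp only [Pi.add_apply, Pi.smul_apply, smul_eq_mul, Finset.smul_sum,
        ← Finset.sum_add_distrib, smul_smul, add_smul]
  refine convexHull_min ?_ hc hy
  rintro _ ⟨l, h1, -, h3, rfl⟩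
  by_cases hl : l = []
  · subst hl
    exact ⟨0, by simp, by simp, by simp [firstActive]⟩
  · refine ⟨Pi.single ⟨l, hl, h1, h3⟩ 1, fun l' => ?_, by simp [Pi.single_apply], ?_⟩
    · by_cases h : l' = ⟨l, hl, h1, h3⟩
      · subst h; simp
      · simp [h]
    · simp [Pi.single_apply, ite_smul]

lemma exists_lpFeasible (G : StochasticGraph) (y : G.V → G.U → ℝ)
    (hy : ∀ v, y v ∈ G.vertexPolytope v) (h : ∀ u, ∑ v, y v u ≤ 1) :
    ∃ x : G.LPVars, G.LPFeasible x ∧ ∀ v, G.lpMarginal x v = y v := by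
  choose x hx0 hx1 hxy using fun v => G.exists_of_mem_vertexPolytope v (hy v)
  have e : ∀ v, G.lpMarginal x v = y v := fun v => (hxy v).symm
  exact ⟨x, (G.lpFeasible_iff x).2 ⟨fun u => by simpa only [e] using h u, hx1, hx0⟩, e⟩

lemma IsLPOptimum.sum_le {G : StochasticGraph} {x : G.LPVars} (hx : G.IsLPOptimum x)
    (y : G.V → G.U → ℝ) (hy : ∀ v, y v ∈ G.vertexPolytope v) (h : ∀ u, ∑ v, y v u ≤ 1) :
    ∑ v, ∑ u, G.w u v * y v u ≤ G.lpObjective x := by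
  obtain ⟨z, hz, hzy⟩ := G.exists_lpFeasible y hy h
  have := hx.optimal z hz
  rw [lpObjective_eq] at this
  simpa only [hzy] using this

/-- An optimum solution never uses edges of negative weight. -/
lemma IsLPOptimum.weight_mul_nonneg {G : StochasticGraph} {x : G.LPVars} (hx : G.IsLPOptimum x)
    (v : G.V) (u : G.U) : 0 ≤ G.w u v * G.lpMarginal x v u := by
  have hm := fun v => G.lpMarginal_mem hx.feasible v
  have hnn := G.lpMarginal_nonneg hx.feasible.nonneg
  -- The competitor erases one coordinate at `v`. It stays in the polytope and only relaxes the
  -- offline constraints, so optimality says that the erased term was not negative.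
  have key := hx.sum_le (Function.update (G.lpMarginal x) v (Function.update (G.lpMarginal x v) u 0))
    ?_ ?_
  · rw [lpObjective_eq, ← Finset.add_sum_erase _ _ (Finset.mem_univ v),
      ← Finset.add_sum_erase Finset.univ (fun v => ∑ u, G.w u v * G.lpMarginal x v u)
        (Finset.mem_univ v)] at key
    have e1 : ∑ v' ∈ Finset.univ.erase v, ∑ u', G.w u' v' * Function.update (G.lpMarginal x) v
        (Function.update (G.lpMarginal x v) u 0) v' u' =
        ∑ v' ∈ Finset.univ.erase v, ∑ u', G.w u' v' * G.lpMarginal x v' u' := by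
      refine Finset.sum_congr rfl fun v' hv' => ?_
      rw [Function.update_of_ne (Finset.ne_of_mem_erase hv')]
    rw [e1, Function.update_self, ← Finset.add_sum_erase _ _ (Finset.mem_univ u),
      ← Finset.add_sum_erase Finset.univ (fun u => G.w u v * G.lpMarginal x v u)
        (Finset.mem_univ u)] at key
    have e2 : ∑ u' ∈ Finset.univ.erase u, G.w u' v * Function.update (G.lpMarginal x v) u 0 u' =
        ∑ u' ∈ Finset.univ.erase u, G.w u' v * G.lpMarginal x v u' := by
      refine Finset.sum_congr rfl fun u' hu' => ?_
      rw [Function.update_of_ne (Finset.ne_of_mem_erase hu')]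
    rw [e2, Function.update_self] at key
    linarith
  · intro v'
    by_cases h : v' = v
    · subst h
      rw [Function.update_self]
      exact update_zero_mem_probePolytope (fun u => G.p_nonneg u v') (fun u => G.p_le_one u v')
        (hm v') u
    · rw [Function.update_of_ne h]
      exact hm v'
  · intro u'
    refine le_trans (Finset.sum_le_sum fun v' _ => ?_) (((G.lpFeasible_iff x).1 hx.feasible).1 u')
    by_cases h : v' = v
    · subst h
      rw [Function.update_self]
      by_cases hu : u' = u
      · subst hu
        rw [Function.update_self]
        exact hnn v' u'
      · rw [Function.update_of_ne hu]
    · rw [Function.update_of_ne h]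

/-! ### The linear program is a relaxation of the committal benchmark -/

lemma sum_stateProb_mul (G : StochasticGraph) (f : (G.U → G.V → Bool) → ℝ) :
    ∑ st, G.stateProb st * f st =
      bernExp (fun e : G.U × G.V => G.p e.1 e.2) (fun s => f fun a b => s (a, b)) := by
  unfold bernExp
  refine (Fintype.sum_equiv (Equiv.curry G.U G.V Bool) _ _ fun s => ?_).symm
  unfold stateProb
  rw [Fintype.prod_prod_type]
  rfl

lemma strategyValue_eq (G : StochasticGraph) (A : Strategy G.U G.V) :
    G.strategyValue A = ∑ v, ∑ u, G.w u v * marginal (fun e => G.p e.1 e.2) A ∅ v u := by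
  have : ∀ v u, marginal (fun e : G.U × G.V => G.p e.1 e.2) A ∅ v u =
      ∑ st, G.stateProb st * (if (u, v) ∈ A.run st ∅ then 1 else 0) := fun v u =>
    (G.sum_stateProb_mul fun st => if (u, v) ∈ A.run st ∅ then 1 else 0).symm
  simp only [this, strategyValue, Finset.mul_sum]
  have h2 : ∀ v, ∑ u, ∑ st, G.w u v * (G.stateProb st * if (u, v) ∈ A.run st ∅ then 1 else 0) =
    ∑ st, ∑ u, G.w u v * (G.stateProb st * if (u, v) ∈ A.run st ∅ then 1 else 0) :=
    fun v => Finset.sum_comm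
  simp only [h2]
  rw [Finset.sum_comm]
  refine Finset.sum_congr rfl fun st _ => ?_
  rw [Finset.sum_comm, ← Fintype.sum_prod_type']
  unfold weight
  rw [Finset.mul_sum, ← Finset.sum_subset (Finset.subset_univ (A.run st ∅))]
  · exact Finset.sum_congr rfl fun e he => by simp [he, mul_comm]
  · intro e _ he
    simp [he]

lemma sum_marginal_le_one (G : StochasticGraph) (A : Strategy G.U G.V) (u : G.U) :
    ∑ v, marginal (fun e : G.U × G.V => G.p e.1 e.2) A ∅ v u ≤ 1 := by
  rw [← bernExp_one (fun e : G.U × G.V => G.p e.1 e.2)]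
  unfold marginal
  have : ∑ v, bernExp (fun e : G.U × G.V => G.p e.1 e.2)
      (fun s => if (u, v) ∈ A.run (fun a b => s (a, b)) ∅ then 1 else 0) =
      bernExp (fun e : G.U × G.V => G.p e.1 e.2)
      (fun s => ∑ v, if (u, v) ∈ A.run (fun a b => s (a, b)) ∅ then 1 else 0) := by
    unfold bernExp
    rw [Finset.sum_comm]
    simp only [Finset.mul_sum]
  rw [this]
  refine bernExp_mono (fun e => G.p_nonneg _ _) (fun e => G.p_le_one _ _) fun s => ?_
  rw [Finset.sum_boole]
  have hinj := injOn_fst_run (fun a b => s (a, b)) A ∅ (by simp)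
  have : (Finset.univ.filter fun v => (u, v) ∈ A.run (fun a b => s (a, b)) ∅).card ≤ 1 := by
    refine Finset.card_le_one.2 fun v hv v' hv' => ?_
    have := hinj (x₁ := (u, v)) (x₂ := (u, v')) (by simpa using hv) (by simpa using hv') rfl
    exact congrArg Prod.snd this
  exact_mod_cast this

lemma OPT_le_lpObjective (G : StochasticGraph) {x : G.LPVars} (hx : G.IsLPOptimum x) :
    G.OPT ≤ G.lpObjective x := by
  refine csSup_le ⟨_, .halt, trivial, rfl⟩ ?_
  rintro _ ⟨A, hA, rfl⟩
  rw [strategyValue_eq]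
  refine hx.sum_le _ (fun v => ?_) (G.sum_marginal_le_one A)
  exact marginal_mem_probePolytope (G.p · v) A v _ (fun _ => G.p_nonneg _ _)
    (fun _ => G.p_le_one _ _) _ hA ∅ (by simp) Set.univ (fun _ _ => rfl) (by simp)

end StochasticGraph

/-! ### The expected weight for a fixed arrival order -/

lemma firstActive_update {U : Type} [DecidableEq U] (p : U → ℝ) (a : U) (c : ℝ) {l : List U}
    (ha : a ∉ l) : firstActive (Function.update p a c) l = firstActive p l := by
  induction l with
  | nil => rfl
  | cons b l ih =>
    simp only [List.mem_cons, not_or] at ha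
    simp only [firstActive, ih ha.2, Function.update_of_ne (Ne.symm ha.1)]

/-- Condition on the first entry. Distinctness of the entries ensures that the remaining list does
not see the overwritten parameter. -/
lemma bernExp_find? {U : Type} [Fintype U] [DecidableEq U] (p : U → ℝ) {l : List U} (hl : l.Nodup)
    (u : U) : bernExp p (fun s => if l.find? s = some u then 1 else 0) = firstActive p l u := by
  induction l generalizing p with
  | nil => simpa [firstActive] using bernExp_const p 0
  | cons a l ih =>
    have h1 := bernExp_update_congr p a true
      (f := fun s => if (a :: l).find? s = some u then (1 : ℝ) else 0)
      (g := fun _ => if a = u then 1 else 0) (fun s hs => by simp [hs])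
    have h0 := bernExp_update_congr p a false
      (f := fun s => if (a :: l).find? s = some u then (1 : ℝ) else 0)
      (g := fun s => if l.find? s = some u then 1 else 0) (fun s hs => by simp [hs])
    rw [bernExp_const] at h1
    simp only [if_true, Bool.false_eq_true, if_false] at h1 h0
    rw [bernExp_split p _ a, h1, h0, ih _ (List.nodup_cons.1 hl).2,
      firstActive_update _ _ _ (List.nodup_cons.1 hl).1]
    simp only [firstActive, Pi.add_apply, Pi.smul_apply, smul_eq_mul, Pi.single_apply,
      mul_ite, mul_one, mul_zero, eq_comm]

/-- Unrolls a recursion into a sum over the first success: for indicators `b`, the product singles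
out the least `t` with `b t = 1`. -/
lemma foldr_finRange {n : ℕ} (a b : Fin n → ℝ) :
    (List.finRange n).foldr (fun t acc => b t * a t + (1 - b t) * acc) 0 =
      ∑ t, a t * ∏ s, (if s < t then 1 - b s else if s = t then b s else 1) := by
  induction n with
  | zero => simp
  | succ n ih =>
    rw [List.finRange_succ, List.foldr_cons, List.foldr_map, ih (fun t => a t.succ)
      (fun t => b t.succ), Fin.sum_univ_succ]
    congr 1
    · rw [Fin.prod_univ_succ]
      have : ∀ s : Fin n, s.succ ≠ 0 := Fin.succ_ne_zero
      simp [this, mul_comm]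
    · rw [Finset.mul_sum]
      refine Finset.sum_congr rfl fun t _ => ?_
      rw [Fin.prod_univ_succ]
      simp only [Fin.succ_pos, if_true, Fin.succ_lt_succ_iff, Fin.succ_inj]
      ring

namespace StochasticGraph

/-- The offline vertices decouple: each free `u` earns the weight at the first arrival, not skipped,
whose probe returns `u`, whatever happens to the others. -/
lemma weight_foldl (G : StochasticGraph) {n : ℕ} (σ : Fin n → G.V) (skip : Fin n → Prop)
    [DecidablePred skip] (R : Fin n → Option G.U) (L : List (Fin n)) (M : Finset (G.U × G.V)) :
    G.weight (L.foldl (fun M t => if skip t then M else addEdge M (σ t) (R t)) M) =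
      G.weight M + ∑ u, if ∃ e ∈ M, e.1 = u then 0 else
        L.foldr (fun t acc => (if ¬ skip t ∧ R t = some u then 1 else 0) * G.w u (σ t) +
          (1 - if ¬ skip t ∧ R t = some u then 1 else 0) * acc) 0 := by
  induction L generalizing M with
  | nil => simp
  | cons t L ih =>
    rw [List.foldl_cons, ih]
    simp only [List.foldr_cons]
    by_cases hs : skip t
    · simp [hs]
    · rcases hR : R t with _ | a
      · simp [hs, addEdge]
      · by_cases ha : ∃ e ∈ M, e.1 = a
        · have : addEdge M (σ t) (some a) = M := by
            obtain ⟨e, he, hea⟩ := ha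
            exact if_neg fun h => h e he hea
          simp only [hs, if_false, this]
          congr 1
          refine Finset.sum_congr rfl fun u _ => ?_
          by_cases hu : ∃ e ∈ M, e.1 = u
          · simp [hu]
          · have : a ≠ u := fun h => hu (h ▸ ha)
            simp [this]
        · have : addEdge M (σ t) (some a) = insert (a, σ t) M :=
            if_pos fun e he h => ha ⟨e, he, h⟩
          simp only [hs, if_false, this]
          have hw : G.weight (insert (a, σ t) M) = G.w a (σ t) + G.weight M :=
            Finset.sum_insert fun h => ha ⟨_, h, rfl⟩
          rw [hw, add_comm (G.w a (σ t)), add_assoc]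
          congr 1
          rw [← Finset.add_sum_erase _ _ (Finset.mem_univ a),
            ← Finset.add_sum_erase Finset.univ (fun u => if ∃ e ∈ M, e.1 = u then 0 else
              (if ¬ False ∧ some a = some u then 1 else 0) * G.w u (σ t) + _)
              (Finset.mem_univ a)]
          rw [if_pos ⟨(a, σ t), by simp, rfl⟩, if_neg ha, zero_add]
          congr 1
          · simp
          · refine Finset.sum_congr rfl fun u hu => ?_
            have hua : a ≠ u := (Finset.ne_of_mem_erase hu).symm
            have e1 : (∃ e ∈ insert (a, σ t) M, e.1 = u) ↔ ∃ e ∈ M, e.1 = u := by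
              simp [hua]
            simp only [e1]
            simp [hua]

lemma weight_algMatching (G : StochasticGraph) (α : ℝ) (σ : G.ArrivalOrder)
    (st : G.U → G.V → Bool) (c : G.Draws σ) :
    G.weight (G.algMatching α σ st c) = ∑ u, ∑ t, G.w u (σ t) *
      ∏ s, (if s < t then
          1 - (if ¬ ((s.val + 1 : ℕ) : ℝ) < G.numOnline * α ∧
            vertexProbe (fun u => st u (σ s)) (c s) = some u then 1 else 0)
        else if s = t then
          (if ¬ ((s.val + 1 : ℕ) : ℝ) < G.numOnline * α ∧
            vertexProbe (fun u => st u (σ s)) (c s) = some u then 1 else 0)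
        else 1) := by
  unfold algMatching
  refine (G.weight_foldl σ (fun t => ((t.val + 1 : ℕ) : ℝ) < G.numOnline * α)
    (fun t => vertexProbe (fun u => st u (σ t)) (c t)) _ ∅).trans ?_
  simp only [Finset.notMem_empty, false_and, exists_false, if_false, foldr_finRange]
  simp [weight]

/-- The edge states of distinct arrivals and the random draws are independent. -/
lemma sum_sum_stateProb_mul_prod (G : StochasticGraph) (σ : G.ArrivalOrder)
    (d : (t : Fin G.numOnline) → Option (ProbeTuple G.U (G.patience (σ t))) → ℝ)
    (h : (t : Fin G.numOnline) → (G.U → Bool) → Option (ProbeTuple G.U (G.patience (σ t))) → ℝ) :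
    ∑ st : G.U → G.V → Bool, ∑ c : G.Draws σ, G.stateProb st * (∏ t, d t (c t)) *
      (∏ t, h t (fun u => st u (σ t)) (c t)) =
    ∏ t, bernExp (G.p · (σ t)) (fun s => ∑ o, d t o * h t s o) := by
  have e1 : ∀ st : G.U → G.V → Bool, ∑ c : G.Draws σ, G.stateProb st * (∏ t, d t (c t)) *
      (∏ t, h t (fun u => st u (σ t)) (c t)) =
      ∏ t, ((∏ u, if st u (σ t) then G.p u (σ t) else 1 - G.p u (σ t)) *
        ∑ o, d t o * h t (fun u => st u (σ t)) o) := by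
    intro st
    rw [Finset.prod_mul_distrib, Finset.prod_univ_sum, Fintype.piFinset_univ, Finset.mul_sum]
    refine Finset.sum_congr rfl fun c _ => ?_
    rw [mul_assoc, ← Finset.prod_mul_distrib]
    congr 1
    unfold stateProb
    rw [Finset.prod_comm, ← Equiv.prod_comp σ]
  simp only [e1, bernExp]
  rw [Finset.prod_univ_sum, Fintype.piFinset_univ]
  refine Fintype.sum_equiv ((Equiv.piComm fun _ _ => Bool).trans
    (Equiv.arrowCongr σ.symm (Equiv.refl _))) _ _ fun st => ?_
  rfl

lemma sum_drawProb {U : Type} [Fintype U] [DecidableEq U] {ℓ : ℕ} (x : ProbeTuple U ℓ → ℝ) :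
    ∑ o, drawProb x o = 1 := by
  simp [Fintype.sum_option, drawProb]

lemma bernExp_vertexProbe {U : Type} [Fintype U] [DecidableEq U] {ℓ : ℕ} (p : U → ℝ)
    (x : ProbeTuple U ℓ → ℝ) (u : U) :
    bernExp p (fun s => ∑ o, drawProb x o * if vertexProbe s o = some u then 1 else 0) =
      ∑ l, x l * firstActive p l.1 u := by
  have : ∀ s, ∑ o, drawProb x o * (if vertexProbe s o = some u then (1 : ℝ) else 0) =
      ∑ l, x l * if l.1.find? s = some u then 1 else 0 := by
    intro s
    simp only [Fintype.sum_option, drawProb, vertexProbe, reduceCtorEq, if_false, mul_zero, zero_add]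
    rfl
  have h2 : ∀ l : ProbeTuple U ℓ, firstActive p l.1 u =
      bernExp p (fun s => if l.1.find? s = some u then 1 else 0) := fun l =>
    (bernExp_find? p l.2.2.1 u).symm
  simp only [this, h2]
  unfold bernExp
  simp only [Finset.mul_sum]
  rw [Finset.sum_comm]
  exact Finset.sum_congr rfl fun l _ => Finset.sum_congr rfl fun s _ => mul_left_comm _ _ _

/-- The probability that `VertexProbe` returns `u` when `v` is the last arrival in `T`. -/
noncomputable def arrivalMarginal (G : StochasticGraph) (solve : LPRule) (T : Finset G.V) (v : G.V)
    (u : G.U) : ℝ :=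
  if h : v ∈ T then (G.induce T).lpMarginal (solve (G.induce T)) ⟨v, h⟩ u else 0

lemma sum_arrivalVars (G : StochasticGraph) (solve : LPRule) (σ : G.ArrivalOrder)
    (t : Fin G.numOnline) (u : G.U) :
    ∑ l, G.arrivalVars solve σ t l * firstActive (G.p · (σ t)) l.1 u =
      G.arrivalMarginal solve (G.arrived σ t) (σ t) u := by
  unfold arrivalMarginal
  rw [dif_pos (G.mem_arrived σ t)]
  exact ((G.induce (G.arrived σ t)).lpMarginal_apply (solve _) ⟨σ t, G.mem_arrived σ t⟩ u).symm

/-- By linearity it suffices to treat one pair `u`, `t`, where the indicator is a product of factors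
each depending on a single arrival; independence then averages it factor by factor. -/
lemma sum_sum_weight_algMatching (G : StochasticGraph) (α : ℝ) (solve : LPRule)
    (σ : G.ArrivalOrder) :
    ∑ st : G.U → G.V → Bool, ∑ c : G.Draws σ,
      G.stateProb st * (∏ t, drawProb (G.arrivalVars solve σ t) (c t)) *
        G.weight (G.algMatching α σ st c) =
    ∑ u, ∑ t, G.w u (σ t) * ∏ s : Fin G.numOnline,
      (if s < t then 1 - (if ((s.val + 1 : ℕ) : ℝ) < G.numOnline * α then 0 else
          G.arrivalMarginal solve (G.arrived σ s) (σ s) u)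
        else if s = t then (if ((s.val + 1 : ℕ) : ℝ) < G.numOnline * α then 0 else
          G.arrivalMarginal solve (G.arrived σ s) (σ s) u)
        else 1) := by
  let b : G.U → (s : Fin G.numOnline) → (G.U → Bool) →
      Option (ProbeTuple G.U (G.patience (σ s))) → ℝ := fun u s col o =>
    if ¬ ((s.val + 1 : ℕ) : ℝ) < G.numOnline * α ∧ vertexProbe col o = some u then 1 else 0
  let h : G.U → Fin G.numOnline → (s : Fin G.numOnline) → (G.U → Bool) →
      Option (ProbeTuple G.U (G.patience (σ s))) → ℝ := fun u t s col o =>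
    if s < t then 1 - b u s col o else if s = t then b u s col o else 1
  have e1 : ∀ (st : G.U → G.V → Bool) (c : G.Draws σ), G.weight (G.algMatching α σ st c) =
      ∑ u, ∑ t, G.w u (σ t) * ∏ s, h u t s (fun u => st u (σ s)) (c s) := fun st c =>
    G.weight_algMatching α σ st c
  have hb : ∀ u s, bernExp (G.p · (σ s))
      (fun col => ∑ o, drawProb (G.arrivalVars solve σ s) o * b u s col o) =
      if ((s.val + 1 : ℕ) : ℝ) < G.numOnline * α then 0 else
          G.arrivalMarginal solve (G.arrived σ s) (σ s) u := by
    intro u s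
    split_ifs with hs
    · simp only [b, hs, not_true, false_and, if_false, mul_zero, Finset.sum_const_zero]
      exact bernExp_const _ 0
    · simp only [b, hs, not_false_iff, true_and]
      rw [bernExp_vertexProbe, sum_arrivalVars]
  simp only [e1, Finset.mul_sum]
  have swap : ∀ F : (G.U → G.V → Bool) → G.Draws σ → G.U → Fin G.numOnline → ℝ,
      ∑ st, ∑ c, ∑ u, ∑ t, F st c u t = ∑ u, ∑ t, ∑ st, ∑ c, F st c u t := by
    intro F
    simp only [Finset.sum_comm (s := (Finset.univ : Finset (G.Draws σ)))
      (t := (Finset.univ : Finset G.U)), Finset.sum_comm (s := (Finset.univ : Finset (G.Draws σ)))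
      (t := (Finset.univ : Finset (Fin G.numOnline)))]
    rw [Finset.sum_comm]
    exact Finset.sum_congr rfl fun u _ => Finset.sum_comm
  rw [swap]
  refine Finset.sum_congr rfl fun u _ => Finset.sum_congr rfl fun t _ => ?_
  have e2 : ∀ (st : G.U → G.V → Bool) (c : G.Draws σ),
      G.stateProb st * (∏ t, drawProb (G.arrivalVars solve σ t) (c t)) *
        (G.w u (σ t) * ∏ s, h u t s (fun u => st u (σ s)) (c s)) =
      G.w u (σ t) * (G.stateProb st * (∏ t, drawProb (G.arrivalVars solve σ t) (c t)) *
        ∏ s, h u t s (fun u => st u (σ s)) (c s)) := fun st c => by ring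
  simp only [e2, ← Finset.mul_sum]
  rw [G.sum_sum_stateProb_mul_prod σ (fun t => drawProb (G.arrivalVars solve σ t)) (h u t)]
  congr 1
  refine Finset.prod_congr rfl fun s _ => ?_
  by_cases h1 : s < t
  · simp only [h, h1, if_true]
    rw [← hb u s]
    have : ∀ col, ∑ o, drawProb (G.arrivalVars solve σ s) o * (1 - b u s col o) =
        1 - ∑ o, drawProb (G.arrivalVars solve σ s) o * b u s col o := by
      intro col
      simp only [mul_sub, mul_one, Finset.sum_sub_distrib, sum_drawProb]
    simp only [this]
    conv_lhs => unfold bernExp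
    simp only [mul_sub, Finset.sum_sub_distrib]
    exact congrArg₂ _ (bernExp_const (G.p · (σ s)) 1) rfl
  · by_cases h2 : s = t
    · subst h2
      simp only [h, if_true, lt_irrefl, if_false]
      exact hb u s
    · simp only [h, h1, h2, if_false, mul_one, sum_drawProb]
      exact bernExp_const _ 1

end StochasticGraph

/-! ### Averaging over the arrival order -/

lemma Fin.prod_ite_lt_succ {n k : ℕ} (hk : k < n) (f : Fin n → ℝ) :
    ∏ s : Fin n, (if s.val < k + 1 then f s else 1) =
      f ⟨k, hk⟩ * ∏ s : Fin n, (if s.val < k then f s else 1) := by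
  rw [← Finset.mul_prod_erase _ _ (Finset.mem_univ (⟨k, hk⟩ : Fin n)),
    ← Finset.mul_prod_erase Finset.univ (fun s : Fin n => if s.val < k then f s else 1)
      (Finset.mem_univ (⟨k, hk⟩ : Fin n))]
  simp only [Nat.lt_succ_self, if_true, lt_irrefl, if_false, one_mul]
  congr 1
  refine Finset.prod_congr rfl fun s hs => ?_
  have : s.val ≠ k := fun h => Finset.ne_of_mem_erase hs (Fin.ext h)
  have : s.val < k + 1 ↔ s.val < k := by omega
  simp only [this]

namespace StochasticGraph

variable (G : StochasticGraph)

lemma mem_arrived_iff (σ : G.ArrivalOrder) (t : Fin G.numOnline) (v : G.V) :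
    v ∈ G.arrived σ t ↔ σ.symm v ≤ t := by
  unfold arrived
  simp only [Finset.mem_image, Finset.mem_filter, Finset.mem_univ, true_and]
  constructor
  · rintro ⟨s, hs, rfl⟩
    simpa using hs
  · exact fun h => ⟨_, h, by simp⟩

lemma arrived_swap (σ : G.ArrivalOrder) {i j t : Fin G.numOnline} (hi : i ≤ t) (hj : j ≤ t) :
    G.arrived ((Equiv.swap i j).trans σ) t = G.arrived σ t := by
  ext v
  rw [mem_arrived_iff, mem_arrived_iff, Equiv.symm_trans_apply, Equiv.symm_swap,
    Equiv.swap_apply_def]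
  split_ifs with h1 h2
  · simp [h1, hi, hj]
  · simp [h2, hi, hj]
  · rfl

lemma sum_swap (F : G.ArrivalOrder → ℝ) (i j : Fin G.numOnline) :
    ∑ σ, F ((Equiv.swap i j).trans σ) = ∑ σ, F σ := by
  refine Fintype.sum_bijective (fun σ : G.ArrivalOrder => (Equiv.swap i j).trans σ)
    (Function.Involutive.bijective fun σ => ?_) _ _ fun _ => rfl
  ext k
  simp

lemma sum_arrived (σ : G.ArrivalOrder) (t : Fin G.numOnline) (f : G.V → ℝ) :
    ∑ v ∈ G.arrived σ t, f v = ∑ j ∈ Finset.univ.filter (fun s => s ≤ t), f (σ j) :=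
  Finset.sum_image fun _ _ _ _ h => σ.injective h

/-- Given the set of the first arrivals and everything later, the last of these arrivals is uniformly
random. -/
lemma sum_last_arrival (t : Fin G.numOnline) (H : G.ArrivalOrder → ℝ)
    (hH : ∀ i ≤ t, ∀ j ≤ t, ∀ σ : G.ArrivalOrder, H ((Equiv.swap i j).trans σ) = H σ)
    (q : Finset G.V → G.V → ℝ) :
    ((t.val : ℝ) + 1) * ∑ σ, H σ * q (G.arrived σ t) (σ t) =
      ∑ σ, H σ * ∑ v ∈ G.arrived σ t, q (G.arrived σ t) v := by
  simp only [sum_arrived, Finset.mul_sum (s := Finset.univ.filter _)]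
  rw [Finset.sum_comm]
  -- Swapping positions `t` and `j` preserves the arrived set and `H`, and makes the arrival at `j`
  -- the last one.
  have : ∀ j ∈ Finset.univ.filter (fun s => s ≤ t),
      ∑ σ, H σ * q (G.arrived σ t) (σ j) = ∑ σ, H σ * q (G.arrived σ t) (σ t) := by
    intro j hj
    have hj : j ≤ t := by simpa using hj
    rw [← G.sum_swap _ t j]
    refine Finset.sum_congr rfl fun σ _ => ?_
    rw [hH t le_rfl j hj, G.arrived_swap σ le_rfl hj]
    simp
  rw [Finset.sum_congr rfl this, Finset.sum_const, nsmul_eq_mul]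
  congr 1
  have : (Finset.univ.filter fun s => s ≤ t) = Finset.Iic t := by ext; simp
  rw [this, Fin.card_Iic]
  push_cast
  rfl

/-- The averaged probability that none of the first `k` arrivals is matched to a fixed offline vertex,
where `q s T v` is the probability that `v` is matched to it, when `v` is the arrival `s` and `T` is
the set of the vertices arrived by then. With `ε = 1` this bounds the average from below, with
`ε = -1` from above. -/
lemma sum_mul_prod_one_sub (ε : ℝ) (q : Fin G.numOnline → Finset G.V → G.V → ℝ)
    (c : Fin G.numOnline → ℝ) (hc1 : ∀ s, c s ≤ 1)
    (hq1 : ∀ s T v, q s T v ≤ 1) (hq : ∀ s T, T.Nonempty → ε * ∑ v ∈ T, q s T v ≤ ε * c s)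
    (k : ℕ) (hk : k ≤ G.numOnline) (H : G.ArrivalOrder → ℝ) (hH0 : ∀ σ, 0 ≤ H σ)
    (hH : ∀ i j : Fin G.numOnline, i.val < k → j.val < k → ∀ σ : G.ArrivalOrder,
      H ((Equiv.swap i j).trans σ) = H σ) :
    ε * ((∏ s : Fin G.numOnline, (if s.val < k then 1 - c s / (s.val + 1) else 1)) * ∑ σ, H σ) ≤
      ε * ∑ σ, H σ * ∏ s : Fin G.numOnline,
        (if s.val < k then 1 - q s (G.arrived σ s) (σ s) else 1) := by
  induction k generalizing H with
  | zero => simp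
  | succ k ih =>
    simp only [Fin.prod_ite_lt_succ hk]
    set t : Fin G.numOnline := ⟨k, hk⟩ with ht
    have e1 : ∀ σ : G.ArrivalOrder, H σ * ((1 - q t (G.arrived σ t) (σ t)) *
        ∏ s : Fin G.numOnline, (if s.val < k then 1 - q s (G.arrived σ s) (σ s) else 1)) =
        (H σ * (1 - q t (G.arrived σ t) (σ t))) *
        ∏ s : Fin G.numOnline, (if s.val < k then 1 - q s (G.arrived σ s) (σ s) else 1) :=
      fun σ => by ring
    simp only [e1]
    -- The factor of arrival `k` is absorbed into the weight `H`. It depends on the earlier arrivals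
    -- only through their set, so swaps among them leave the new weight unchanged; `hq1` keeps it
    -- nonnegative.
    refine le_trans ?_ (ih (by omega) (fun σ => H σ * (1 - q t (G.arrived σ t) (σ t)))
      (fun σ => mul_nonneg (hH0 σ) (by linarith [hq1 t (G.arrived σ t) (σ t)])) ?_)
    · have hP : 0 ≤ ∏ s : Fin G.numOnline, (if s.val < k then 1 - c s / (s.val + 1) else 1) := by
        refine Finset.prod_nonneg fun s _ => ?_
        split_ifs
        · have : c s / (s.val + 1) ≤ 1 := by
            rw [div_le_one (by positivity)]
            have := hc1 s
            have : (0 : ℝ) ≤ s.val := by positivity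
            linarith
          linarith
        · exact zero_le_one
      have hk1 : (0 : ℝ) < t.val + 1 := by positivity
      have havg := G.sum_last_arrival t H
        (fun i hi j hj => hH i j (Nat.lt_succ_of_le hi) (Nat.lt_succ_of_le hj)) (q t)
      have hle : ε * ∑ σ, H σ * ∑ v ∈ G.arrived σ t, q t (G.arrived σ t) v ≤
          ε * (c t * ∑ σ, H σ) := by
        rw [Finset.mul_sum, Finset.mul_sum, Finset.mul_sum]
        refine Finset.sum_le_sum fun σ _ => ?_
        have := mul_le_mul_of_nonneg_left (hq t (G.arrived σ t) ⟨_, G.mem_arrived σ t⟩) (hH0 σ)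
        linarith
      rw [← havg] at hle
      have hle2 : ε * ∑ σ, H σ * q t (G.arrived σ t) (σ t) ≤
          ε * (c t / (t.val + 1) * ∑ σ, H σ) := by
        have h3 : ε * (c t / (t.val + 1) * ∑ σ, H σ) =
            (ε * (c t * ∑ σ, H σ)) / (t.val + 1) := by field_simp
        rw [h3, le_div_iff₀ hk1]
        linarith
      simp only [mul_sub, mul_one, Finset.sum_sub_distrib] at *
      have := mul_le_mul_of_nonneg_left hle2 hP
      linarith
    · intro i j hi hj σ
      have hi' : i ≤ t := by rw [Fin.le_def]; exact hi.le
      have hj' : j ≤ t := by rw [Fin.le_def]; exact hj.le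
      rw [hH i j (by omega) (by omega), G.arrived_swap σ hi' hj', Equiv.trans_apply,
        Equiv.swap_apply_of_ne_of_ne]
      · intro h; rw [← h] at hi; simp [ht] at hi
      · intro h; rw [← h] at hj; simp [ht] at hj

lemma sum_apply_arrival (t : Fin G.numOnline) (f : G.V → ℝ) :
    (G.numOnline : ℝ) * ∑ σ : G.ArrivalOrder, f (σ t) =
      Fintype.card G.ArrivalOrder * ∑ v, f v := by
  have h1 : ∀ s : Fin G.numOnline, ∑ σ : G.ArrivalOrder, f (σ s) = ∑ σ : G.ArrivalOrder, f (σ t) := by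
    intro s
    rw [← G.sum_swap _ s t]
    simp
  have h2 : ∑ s : Fin G.numOnline, ∑ σ : G.ArrivalOrder, f (σ s) =
      (G.numOnline : ℝ) * ∑ σ : G.ArrivalOrder, f (σ t) := by
    simp [h1]
  rw [← h2, Finset.sum_comm]
  simp only [fun σ : G.ArrivalOrder => Equiv.sum_comp σ f]
  simp

end StochasticGraph

/-! ### The success probability of the secretary rule -/

/-- The success probability of the secretary rule which passes on the arrivals `t < n * α`. -/
noncomputable def secretaryProb (n : ℕ) (α : ℝ) : ℝ :=
  (∑ t : Fin n, if ((t.val + 1 : ℕ) : ℝ) < n * α then 0 else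
    ∏ s : Fin n, (if s.val < t.val then
      1 - (if ((s.val + 1 : ℕ) : ℝ) < n * α then 0 else 1) / ((s.val : ℝ) + 1) else 1)) / n

/-- With `r` arrivals skipped, the factors `1 - 1 / (s + 1) = s / (s + 1)` for `r ≤ s < t` telescope
to `r / t`. -/
lemma secretaryProb_eq {n r : ℕ} {α : ℝ} (hr : 1 ≤ r)
    (h : ∀ t : ℕ, ((t + 1 : ℕ) : ℝ) < n * α ↔ t < r) :
    secretaryProb n α = r / n * ∑ t ∈ Finset.Ico r n, (1 / t : ℝ) := by
  have hr' : (0 : ℝ) < r := by exact_mod_cast hr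
  have hP0 : ∀ k : ℕ, k ≤ n → k ≤ r → ∏ s : Fin n, (if s.val < k then
      1 - (if s.val < r then 0 else 1) / ((s.val : ℝ) + 1) else 1) = 1 := by
    intro k _ hk
    refine Finset.prod_eq_one fun s _ => ?_
    split_ifs <;> first | omega | simp
  have hP : ∀ k : ℕ, k ≤ n → r ≤ k → ∏ s : Fin n, (if s.val < k then
      1 - (if s.val < r then 0 else 1) / ((s.val : ℝ) + 1) else 1) = r / k := by
    intro k hkn hk
    induction k, hk using Nat.le_induction with
    | base => rw [hP0 r hkn le_rfl, div_self hr'.ne']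
    | succ k hk ih =>
      rw [Fin.prod_ite_lt_succ (by omega) (fun s : Fin n =>
        1 - (if s.val < r then 0 else 1) / ((s.val : ℝ) + 1)), ih (by omega)]
      have : ¬ k < r := by omega
      simp only [this, if_false]
      have : (0 : ℝ) < k := lt_of_lt_of_le hr' (by exact_mod_cast hk)
      push_cast
      field_simp
      ring
  unfold secretaryProb
  simp only [h]
  have e : ∀ t : Fin n, (if t.val < r then 0 else ∏ s : Fin n, (if s.val < t.val then
      1 - (if s.val < r then 0 else 1) / ((s.val : ℝ) + 1) else 1)) =
      if r ≤ t.val then (r : ℝ) / t.val else 0 := by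
    intro t
    by_cases ht : t.val < r
    · rw [if_pos ht, if_neg (by omega)]
    · rw [if_neg ht, if_pos (by omega), hP _ t.2.le (by omega)]
  simp only [e]
  rw [Fin.sum_univ_eq_sum_range (fun t => if r ≤ t then (r : ℝ) / t else 0), ← Finset.sum_filter]
  have : (Finset.range n).filter (fun t => r ≤ t) = Finset.Ico r n := by
    ext; simp [and_comm]
  rw [this, Finset.mul_sum, Finset.sum_div]
  exact Finset.sum_congr rfl fun t _ => by ring

/-! ### Harmonic sums and the constant `1 / e`. -/

lemma Real.log_le_half_sub_inv {x : ℝ} (hx : 1 ≤ x) : Real.log x ≤ (x - x⁻¹) / 2 := by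
  have h := Real.self_le_sinh_iff.2 (Real.log_nonneg hx)
  rwa [Real.sinh_eq, Real.exp_neg, Real.exp_log (by linarith)] at h

lemma Real.two_mul_div_le_log {y : ℝ} (hy : 1 ≤ y) : 2 * (y - 1) / (y + 1) ≤ Real.log y := by
  have h := Real.le_log_one_add_of_nonneg (x := y - 1) (by linarith)
  have e : (1 : ℝ) + (y - 1) = y := by ring
  have e2 : y - 1 + 2 = y + 1 := by ring
  rwa [e, e2] at h

/-- The trapezoidal rule overestimates the integral of the convex function `1 / x`. The resulting
correction term is what gives `1 / e` with no error for finite `n`. -/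
lemma log_le_sum_Ico {r n : ℕ} (hr : 1 ≤ r) (hn : r ≤ n) :
    Real.log (n / r) + (1 / r - 1 / n) / 2 ≤ ∑ t ∈ Finset.Ico r n, (1 / t : ℝ) := by
  have hr' : (0 : ℝ) < r := by exact_mod_cast hr
  induction n, hn using Nat.le_induction with
  | base => simp [hr'.ne']
  | succ n hn ih =>
    have hn' : (0 : ℝ) < n := lt_of_lt_of_le hr' (by exact_mod_cast hn)
    rw [Finset.sum_Ico_succ_top hn]
    have h := Real.log_le_half_sub_inv (x := (n + 1) / n) (by rw [le_div_iff₀ hn']; linarith)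
    have e1 : Real.log ((n + 1 : ℕ) / r) = Real.log (n / r) + Real.log ((n + 1) / n) := by
      rw [← Real.log_mul (by positivity) (by positivity)]
      congr 1
      push_cast
      field_simp
    have e2 : (((n : ℝ) + 1) / n - (((n : ℝ) + 1) / n)⁻¹) / 2 = (1 / n + 1 / (n + 1)) / 2 := by
      field_simp
      ring
    rw [e1]
    push_cast
    rw [e2] at h
    linarith

lemma sum_Ico_le_log {r n : ℕ} (hr : 1 ≤ r) (hn : r ≤ n) :
    ∑ t ∈ Finset.Ico r n, (1 / t : ℝ) ≤ Real.log (n / r) + (1 / r - 1 / n) := by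
  have hr' : (0 : ℝ) < r := by exact_mod_cast hr
  induction n, hn using Nat.le_induction with
  | base => simp [hr'.ne']
  | succ n hn ih =>
    have hn' : (0 : ℝ) < n := lt_of_lt_of_le hr' (by exact_mod_cast hn)
    rw [Finset.sum_Ico_succ_top hn]
    have h := Real.one_sub_inv_le_log_of_pos (x := ((n : ℝ) + 1) / n) (by positivity)
    have e1 : Real.log ((n + 1 : ℕ) / r) = Real.log (n / r) + Real.log ((n + 1) / n) := by
      rw [← Real.log_mul (by positivity) (by positivity)]
      congr 1
      push_cast
      field_simp
    have e2 : 1 - (((n : ℝ) + 1) / n)⁻¹ = 1 / (n + 1) := by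
      field_simp
      ring
    rw [e1]
    push_cast
    rw [e2] at h
    linarith

/-- Here `r = ⌈n / e⌉ - 1`, since skipping is decided by a strict inequality; `n ≥ 3 > e` makes it
positive. -/
lemma exists_skip_bound {n : ℕ} (hn : 3 ≤ n) : ∃ r : ℕ, 1 ≤ r ∧
    (∀ t : ℕ, ((t + 1 : ℕ) : ℝ) < n * (1 / Real.exp 1) ↔ t < r) ∧
    (r : ℝ) * Real.exp 1 < n ∧ (n : ℝ) ≤ (r + 1) * Real.exp 1 := by
  have he : Real.exp 1 < 3 := lt_trans Real.exp_one_lt_d9 (by norm_num)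
  have he0 := Real.exp_pos 1
  have hn' : (3 : ℝ) ≤ n := by exact_mod_cast hn
  have h1 : 1 < ⌈(n : ℝ) * (1 / Real.exp 1)⌉₊ := by
    rw [Nat.lt_ceil, mul_one_div, lt_div_iff₀ he0]
    push_cast
    linarith
  have key : ∀ t : ℕ, ((t + 1 : ℕ) : ℝ) < n * (1 / Real.exp 1) ↔
      t < ⌈(n : ℝ) * (1 / Real.exp 1)⌉₊ - 1 := by
    intro t
    rw [← Nat.lt_ceil]
    omega
  set m := ⌈(n : ℝ) * (1 / Real.exp 1)⌉₊
  obtain ⟨r, hr⟩ : ∃ r, m = r + 2 := ⟨m - 2, by omega⟩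
  have e : m - 1 = r + 1 := by omega
  rw [e] at key
  refine ⟨r + 1, by omega, key, ?_, ?_⟩
  · have := (key r).2 (by omega)
    rwa [mul_one_div, lt_div_iff₀ he0] at this
  · have := mt (key (r + 1)).1 (by omega)
    rw [not_lt, mul_one_div, div_le_iff₀ he0] at this
    push_cast at this ⊢
    exact this

lemma secretaryProb_le {n : ℕ} (hn : 3 ≤ n) :
    secretaryProb n (1 / Real.exp 1) ≤ 1 / Real.exp 1 + 1 / n := by
  obtain ⟨r, hr, h, h1, -⟩ := exists_skip_bound hn
  have he0 := Real.exp_pos 1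
  have he1 : 1 < Real.exp 1 := Real.one_lt_exp_iff.2 one_pos
  have hr' : (0 : ℝ) < r := by exact_mod_cast hr
  have hn' : (0 : ℝ) < n := by positivity
  have hrn : r ≤ n := by
    have : (r : ℝ) ≤ n := by nlinarith
    exact_mod_cast this
  rw [secretaryProb_eq hr h]
  have hs := sum_Ico_le_log hr hrn
  -- This is `log x ≤ x - 1` at `x = n / (r e)`.
  have hl : Real.log (n / r) ≤ n / r / Real.exp 1 := by
    have := Real.log_le_sub_one_of_pos (x := n / r / Real.exp 1) (by positivity)
    rw [Real.log_div (by positivity) (by positivity), Real.log_exp] at this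
    linarith
  have hb : ∑ t ∈ Finset.Ico r n, (1 / t : ℝ) ≤ n / r / Real.exp 1 + 1 / r := by
    have : (0 : ℝ) ≤ 1 / n := by positivity
    linarith
  calc (r : ℝ) / n * ∑ t ∈ Finset.Ico r n, (1 / t : ℝ)
      ≤ r / n * (n / r / Real.exp 1 + 1 / r) := by gcongr
    _ = 1 / Real.exp 1 + 1 / n := by field_simp

lemma le_secretaryProb {n : ℕ} (hn : 1 ≤ n) :
    1 / Real.exp 1 ≤ secretaryProb n (1 / Real.exp 1) := by
  have he0 := Real.exp_pos 1
  have he2 : 2.7 < Real.exp 1 := lt_trans (by norm_num) Real.exp_one_gt_d9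
  have he3 : Real.exp 1 < 2.72 := lt_trans Real.exp_one_lt_d9 (by norm_num)
  have hn' : (0 : ℝ) < n := by exact_mod_cast hn
  rcases Nat.lt_or_ge n 3 with h3 | h3
  -- Since `n < e`, nothing is skipped, and the first arrival alone contributes `1 / n ≥ 1 / 2`.
  · have hn2 : (n : ℝ) ≤ 2 := by exact_mod_cast (by omega : n ≤ 2)
    have hskip : ∀ t : ℕ, ¬ ((t + 1 : ℕ) : ℝ) < n * (1 / Real.exp 1) := by
      intro t
      rw [mul_one_div, lt_div_iff₀ he0, not_lt]
      push_cast
      have : (0 : ℝ) ≤ t := by positivity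
      nlinarith
    unfold secretaryProb
    simp only [hskip, if_false]
    have hterm : ∀ t : Fin n, 0 ≤ ∏ s : Fin n,
        (if s.val < t.val then 1 - 1 / ((s.val : ℝ) + 1) else 1) := by
      intro t
      refine Finset.prod_nonneg fun s _ => ?_
      split_ifs
      · have : 1 / ((s.val : ℝ) + 1) ≤ 1 := by
          rw [div_le_one (by positivity)]
          have : (0 : ℝ) ≤ s.val := by positivity
          linarith
        linarith
      · exact zero_le_one
    have h1 : 1 ≤ ∑ t : Fin n, ∏ s : Fin n,
        (if s.val < t.val then 1 - 1 / ((s.val : ℝ) + 1) else 1) := by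
      refine le_trans (le_of_eq ?_) (Finset.single_le_sum (fun t _ => hterm t)
        (Finset.mem_univ (⟨0, hn⟩ : Fin n)))
      simp
    rw [div_le_div_iff₀ he0 hn']
    nlinarith
  · obtain ⟨r, hr, h, h1, h2⟩ := exists_skip_bound h3
    have hr' : (0 : ℝ) < r := by exact_mod_cast hr
    have hrn : r ≤ n := by
      have : (r : ℝ) ≤ n := by nlinarith
      exact_mod_cast this
    rw [secretaryProb_eq hr h]
    suffices hs : n / (r * Real.exp 1) ≤ ∑ t ∈ Finset.Ico r n, (1 / t : ℝ) by
      calc 1 / Real.exp 1 = r / n * (n / (r * Real.exp 1)) := by field_simp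
        _ ≤ _ := by gcongr
    -- The general estimate uses `1 / r ≤ 1 / 2`. For `r = 1` only `n = 3, 4, 5` occur, because `n ≤
    -- 2 e`.
    rcases Nat.lt_or_ge r 2 with hr2 | hr2
    · obtain rfl : r = 1 := by omega
      push_cast at h1 h2 ⊢
      have hn6 : n < 6 := by
        have : (n : ℝ) < 6 := by linarith
        exact_mod_cast this
      rw [one_mul, div_le_iff₀ he0]
      interval_cases n
      · have : ∑ t ∈ Finset.Ico 1 3, (1 / (t : ℕ) : ℝ) = 3 / 2 := by
          norm_num [Finset.sum_Ico_succ_top]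
        rw [this]; push_cast; linarith
      · have : ∑ t ∈ Finset.Ico 1 4, (1 / (t : ℕ) : ℝ) = 11 / 6 := by
          norm_num [Finset.sum_Ico_succ_top]
        rw [this]; push_cast; linarith
      · have : ∑ t ∈ Finset.Ico 1 5, (1 / (t : ℕ) : ℝ) = 25 / 12 := by
          norm_num [Finset.sum_Ico_succ_top]
        rw [this]; push_cast; linarith
    · refine le_trans ?_ (log_le_sum_Ico hr hrn)
      have hr2' : (2 : ℝ) ≤ r := by exact_mod_cast hr2
      -- The target is `y ≤ 1 + log y + (1 / r - 1 / n) / 2`. As `1 ≤ y ≤ 1 + 1 / r`, the defect `y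
      -- - 1 - log y` is at most `1 / (2 r²)`, and `n ≥ 2 r` together with `r ≥ 2` lets the
      -- correction term absorb it.
      set y : ℝ := n / (r * Real.exp 1) with hy
      have hy1 : 1 ≤ y := by
        rw [hy, le_div_iff₀ (by positivity)]; linarith
      have hy2 : y - 1 ≤ 1 / r := by
        rw [hy, sub_le_iff_le_add, div_le_iff₀ (by positivity)]
        have : (1 / r + 1) * (r * Real.exp 1) = (r + 1) * Real.exp 1 := by field_simp; ring
        rw [this]; exact h2
      have hlog : Real.log (n / r) = 1 + Real.log y := by
        have : (n : ℝ) / r = Real.exp 1 * y := by rw [hy]; field_simp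
        rw [this, Real.log_mul he0.ne' (by linarith), Real.log_exp]
      have hly := Real.two_mul_div_le_log hy1
      have hq : (y - 1) - 2 * (y - 1) / (y + 1) ≤ (y - 1) ^ 2 / 2 := by
        have : (y - 1) - 2 * (y - 1) / (y + 1) = (y - 1) ^ 2 / (y + 1) := by
          field_simp; ring
        rw [this]
        exact div_le_div_of_nonneg_left (sq_nonneg _) two_pos (by linarith)
      have hsq : (y - 1) ^ 2 ≤ (1 / r) ^ 2 := pow_le_pow_left₀ (by linarith) hy2 2
      have hfin : (1 / r : ℝ) ^ 2 ≤ 1 / r - 1 / n := by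
        have hnr : (1 : ℝ) / n ≤ 1 / r * (1 / 2) := by
          rw [one_div_mul_one_div]
          refine one_div_le_one_div_of_le (by positivity) ?_
          nlinarith
        have hr3 : (1 : ℝ) / r ≤ 1 / 2 := one_div_le_one_div_of_le two_pos hr2'
        have hr4 : (0 : ℝ) < 1 / r := by positivity
        nlinarith
      rw [hlog]
      linarith

/-! ### The value of the online algorithm -/

lemma prod_ite_lt_eq {n : ℕ} (b : Fin n → ℝ) (t : Fin n) :
    ∏ s, (if s < t then 1 - b s else if s = t then b s else 1) =
      b t * ∏ s : Fin n, (if s.val < t.val then 1 - b s else 1) := by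
  rw [← Finset.mul_prod_erase _ _ (Finset.mem_univ t),
    ← Finset.mul_prod_erase Finset.univ (fun s : Fin n => if s.val < t.val then 1 - b s else 1)
      (Finset.mem_univ t)]
  simp only [lt_irrefl, if_true, if_false, one_mul]
  congr 1
  refine Finset.prod_congr rfl fun s hs => ?_
  simp only [Finset.ne_of_mem_erase hs, if_false]
  rfl

namespace StochasticGraph

variable (G : StochasticGraph) (solve : LPRule)

lemma sum_arrivalMarginal (T : Finset G.V) (φ : G.V → (G.U → ℝ) → ℝ) :
    ∑ v ∈ T, φ v (G.arrivalMarginal solve T v) =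
      ∑ v : (G.induce T).V, φ v.1 ((G.induce T).lpMarginal (solve (G.induce T)) v) := by
  rw [Finset.sum_subtype (F := (G.induce T).fintypeV) T (fun _ => Iff.rfl)]
  refine Finset.sum_congr rfl fun v _ => ?_
  congr 1
  ext u
  exact dif_pos v.2

variable {solve} (hsolve : ∀ H : StochasticGraph, H.IsLPOptimum (solve H))
include hsolve

lemma arrivalMarginal_nonneg (T : Finset G.V) (v : G.V) (u : G.U) :
    0 ≤ G.arrivalMarginal solve T v u := by
  unfold arrivalMarginal
  split_ifs with h
  · exact lpMarginal_nonneg _ (hsolve _).feasible.nonneg _ _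
  · exact le_rfl

lemma sum_arrivalMarginal_le_one (T : Finset G.V) (u : G.U) :
    ∑ v ∈ T, G.arrivalMarginal solve T v u ≤ 1 :=
  (G.sum_arrivalMarginal solve T fun _ y => y u).trans_le
    (((lpFeasible_iff _ _).1 (hsolve (G.induce T)).feasible).1 u)

lemma arrivalMarginal_le_one (T : Finset G.V) (v : G.V) (u : G.U) :
    G.arrivalMarginal solve T v u ≤ 1 := by
  by_cases h : v ∈ T
  · exact (Finset.single_le_sum (f := fun v => G.arrivalMarginal solve T v u)
      (fun v _ => G.arrivalMarginal_nonneg hsolve T v u) h).trans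
      (G.sum_arrivalMarginal_le_one hsolve T u)
  · rw [arrivalMarginal, dif_neg h]
    exact zero_le_one

lemma weight_mul_arrivalMarginal_nonneg (T : Finset G.V) (v : G.V) (u : G.U) :
    0 ≤ G.w u v * G.arrivalMarginal solve T v u := by
  unfold arrivalMarginal
  split_ifs with h
  · exact (hsolve (G.induce T)).weight_mul_nonneg ⟨v, h⟩ u
  · simp

/-- The solution for the arrived vertices is at least as good as any family of marginals. -/
lemma sum_le_sum_arrivalMarginal (T : Finset G.V) (y : G.V → G.U → ℝ)
    (hy : ∀ v, y v ∈ G.vertexPolytope v) (h : ∀ u, ∑ v ∈ T, y v u ≤ 1) :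
    ∑ v ∈ T, ∑ u, G.w u v * y v u ≤ ∑ v ∈ T, ∑ u, G.w u v * G.arrivalMarginal solve T v u := by
  refine le_of_le_of_eq ?_
    (G.sum_arrivalMarginal solve T fun v y => ∑ u, G.w u v * y u).symm
  rw [Finset.sum_subtype (F := (G.induce T).fintypeV) T (fun _ => Iff.rfl)]
  refine ((hsolve (G.induce T)).sum_le (fun v => y v.1) (fun v => hy v.1) fun u => ?_).trans_eq
    (lpObjective_eq _ _)
  have := h u
  rwa [Finset.sum_subtype (F := (G.induce T).fintypeV) T (fun _ => Iff.rfl)] at this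

omit hsolve in
lemma algValue_eq (solve : LPRule) (α : ℝ) : algValue α solve G =
    (∑ t : Fin G.numOnline, if ((t.val + 1 : ℕ) : ℝ) < G.numOnline * α then 0 else
      ∑ u, ∑ σ : G.ArrivalOrder, G.w u (σ t) * G.arrivalMarginal solve (G.arrived σ t) (σ t) u *
        ∏ s : Fin G.numOnline, (if s.val < t.val then 1 - (if ((s.val + 1 : ℕ) : ℝ) < G.numOnline * α
          then 0 else G.arrivalMarginal solve (G.arrived σ s) (σ s) u) else 1)) /
      Fintype.card G.ArrivalOrder := by
  unfold algValue
  congr 1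
  simp only [sum_sum_weight_algMatching]
  rw [Finset.sum_comm]
  simp only [Finset.sum_comm (s := (Finset.univ : Finset G.ArrivalOrder))
    (t := (Finset.univ : Finset (Fin G.numOnline)))]
  rw [Finset.sum_comm]
  refine Finset.sum_congr rfl fun t _ => ?_
  split_ifs with ht
  · refine Finset.sum_eq_zero fun u _ => Finset.sum_eq_zero fun σ _ => ?_
    rw [prod_ite_lt_eq, if_pos ht, zero_mul, mul_zero]
  · refine Finset.sum_congr rfl fun u _ => Finset.sum_congr rfl fun σ _ => ?_
    rw [prod_ite_lt_eq, if_neg ht, mul_assoc]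

/-- The algorithm attains the fraction `secretaryProb` of the value of the linear program. -/
lemma secretaryProb_mul_le_algValue (α : ℝ) (hV : 0 < G.numOnline) :
    secretaryProb G.numOnline α * G.lpObjective (solve G) ≤ algValue α solve G := by
  have hn : (0 : ℝ) < G.numOnline := by exact_mod_cast hV
  have : Nonempty G.ArrivalOrder := ⟨(Fintype.equivFin G.V).symm⟩
  have hcard : (0 : ℝ) < Fintype.card G.ArrivalOrder := by exact_mod_cast Fintype.card_pos
  rw [algValue_eq, le_div_iff₀ hcard]
  unfold secretaryProb
  rw [div_mul_eq_mul_div, div_mul_eq_mul_div, mul_assoc, Finset.sum_mul, Finset.sum_div]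
  refine Finset.sum_le_sum fun t _ => ?_
  split_ifs with ht
  · simp
  set c : Fin G.numOnline → ℝ := fun s => if ((s.val + 1 : ℕ) : ℝ) < G.numOnline * α then 0 else 1
    with hc
  set P : ℝ := ∏ s : Fin G.numOnline, (if s.val < t.val then 1 - c s / ((s.val : ℝ) + 1) else 1)
    with hP
  have hP0 : 0 ≤ P := by
    refine Finset.prod_nonneg fun s _ => ?_
    split_ifs
    · have h1 : c s / ((s.val : ℝ) + 1) ≤ 1 := by
        rw [div_le_one (by positivity)]
        have : c s ≤ 1 := by simp only [hc]; split_ifs <;> norm_num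
        have : (0 : ℝ) ≤ s.val := by positivity
        linarith
      linarith
    · exact zero_le_one
  -- The averaging lemma needs a nonnegative weight. Edge weights may be negative, but an optimum
  -- gives no marginal to such edges.
  have step : ∀ u, P * ∑ σ : G.ArrivalOrder,
      G.w u (σ t) * G.arrivalMarginal solve (G.arrived σ t) (σ t) u ≤
      ∑ σ : G.ArrivalOrder, G.w u (σ t) * G.arrivalMarginal solve (G.arrived σ t) (σ t) u *
        ∏ s : Fin G.numOnline, (if s.val < t.val then 1 - (if ((s.val + 1 : ℕ) : ℝ) < G.numOnline * α
          then 0 else G.arrivalMarginal solve (G.arrived σ s) (σ s) u) else 1) := by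
    intro u
    have := G.sum_mul_prod_one_sub 1
      (fun s T v => if ((s.val + 1 : ℕ) : ℝ) < G.numOnline * α then 0 else
        G.arrivalMarginal solve T v u) c ?_ ?_ ?_ t.val t.2.le
      (fun σ => G.w u (σ t) * G.arrivalMarginal solve (G.arrived σ t) (σ t) u)
      (fun σ => G.weight_mul_arrivalMarginal_nonneg hsolve _ _ _) ?_
    · simpa only [one_mul] using this
    · intro s
      simp only [hc]
      split_ifs <;> norm_num
    · intro s T v
      split_ifs
      · exact zero_le_one
      · exact G.arrivalMarginal_le_one hsolve _ _ _
    · intro s T _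
      simp only [hc]
      split_ifs
      · simp
      · simpa using G.sum_arrivalMarginal_le_one hsolve T u
    · intro i j hi hj σ
      rw [G.arrived_swap σ (Fin.le_def.2 hi.le) (Fin.le_def.2 hj.le), Equiv.trans_apply,
        Equiv.swap_apply_of_ne_of_ne (fun h => by simp [h] at hi) (fun h => by simp [h] at hj)]
  refine le_trans ?_ (Finset.sum_le_sum fun u _ => step u)
  rw [← Finset.mul_sum, mul_div_assoc]
  refine mul_le_mul_of_nonneg_left ?_ hP0
  rw [div_le_iff₀ hn]
  have hx := (hsolve G).feasible
  set y := G.lpMarginal (solve G)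
  have hy0 := G.lpMarginal_nonneg hx.nonneg
  have h1 := G.sum_apply_arrival t fun v => ∑ u, G.w u v * y v u
  have h2 := G.sum_last_arrival t (fun _ => 1) (fun _ _ _ _ _ => rfl)
    (fun _ v => ∑ u, G.w u v * y v u)
  have h3 := G.sum_last_arrival t (fun _ => 1) (fun _ _ _ _ _ => rfl)
    (fun T v => ∑ u, G.w u v * G.arrivalMarginal solve T v u)
  simp only [one_mul] at h2 h3
  -- The last of the first `t + 1` arrivals is uniform among them, so it is enough to compare totals
  -- over the arrived set, where `y` is a feasible competitor.
  have h4 : ∑ σ : G.ArrivalOrder, ∑ u, G.w u (σ t) * y (σ t) u ≤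
      ∑ σ : G.ArrivalOrder, ∑ u, G.w u (σ t) *
        G.arrivalMarginal solve (G.arrived σ t) (σ t) u := by
    have ht0 : (0 : ℝ) < t.val + 1 := by positivity
    refine le_of_mul_le_mul_left ?_ ht0
    rw [h2, h3]
    refine Finset.sum_le_sum fun σ _ => G.sum_le_sum_arrivalMarginal hsolve _ y
      (fun v => G.lpMarginal_mem hx v) fun u => ?_
    exact (Finset.sum_le_sum_of_subset_of_nonneg (Finset.subset_univ _) fun v _ _ => hy0 v u).trans
      (((lpFeasible_iff _ _).1 hx).1 u)
  rw [lpObjective_eq, mul_comm, ← h1, Finset.sum_comm (s := (Finset.univ : Finset G.U)),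
    mul_comm (_ : ℝ) (G.numOnline : ℝ)]
  exact mul_le_mul_of_nonneg_left h4 hn.le

lemma OPT_le_zero_of_numOnline_eq_zero (h : G.numOnline = 0) : G.OPT ≤ 0 := by
  have : IsEmpty G.V := Fintype.card_eq_zero_iff.1 h
  refine (G.OPT_le_lpObjective (hsolve G)).trans_eq ?_
  simp [lpObjective]

lemma ratio_ge (hOPT : 0 < G.OPT) :
    1 / Real.exp 1 ≤ algValue (1 / Real.exp 1) solve G / G.OPT := by
  have hV : 0 < G.numOnline := by
    by_contra h
    exact absurd (G.OPT_le_zero_of_numOnline_eq_zero hsolve (by omega)) (not_le.2 hOPT)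
  rw [le_div_iff₀ hOPT]
  have hle := G.OPT_le_lpObjective (hsolve G)
  calc 1 / Real.exp 1 * G.OPT
      ≤ secretaryProb G.numOnline (1 / Real.exp 1) * G.lpObjective (solve G) :=
        mul_le_mul (le_secretaryProb hV) hle hOPT.le
          ((by positivity : (0 : ℝ) ≤ 1 / Real.exp 1).trans (le_secretaryProb hV))
    _ ≤ _ := G.secretaryProb_mul_le_algValue hsolve _ hV

omit hsolve

/-! ### The secretary problem as a stochastic graph -/

/-- The stochastic graph `G` has one offline vertex, all edges are active and may be probed, the edge
at `z` has weight `B`, and all the others have weight `1`. -/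
structure IsSecretary (G : StochasticGraph) (B : ℝ) (z : G.V) : Prop where
  offline_eq : ∀ u u' : G.U, u = u'
  p_eq : ∀ u v, G.p u v = 1
  w_eq : ∀ u v, G.w u v = if v = z then B else 1
  patience_pos : ∀ v, 0 < G.patience v

lemma IsSecretary.sum_offline {G : StochasticGraph} {B : ℝ} {z : G.V} (hG : G.IsSecretary B z)
    (u₀ : G.U) (f : G.U → ℝ) : ∑ u, f u = f u₀ := by
  have : Unique G.U := ⟨⟨u₀⟩, fun u => hG.offline_eq u u₀⟩
  rw [Fintype.sum_unique, hG.offline_eq default u₀]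

lemma IsSecretary.le_OPT {G : StochasticGraph} {B : ℝ} {z : G.V} (hG : G.IsSecretary B z)
    (u₀ : G.U) : B ≤ G.OPT := by
  refine le_csSup G.bddAbove_strategyValue
    ⟨.probe u₀ z fun _ => .halt, ⟨hG.patience_pos z, fun _ => trivial⟩, ?_⟩
  have h : ∀ v, marginal (fun e : G.U × G.V => G.p e.1 e.2)
      (Strategy.probe u₀ z fun _ => .halt) ∅ v u₀ = if v = z then 1 else 0 := by
    intro v
    rw [marginal_probe, hG.p_eq, one_smul, sub_self, zero_smul, add_zero]
    refine (bernExp_const _ (if (u₀, v) ∈ commit ∅ u₀ z true then 1 else 0)).trans ?_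
    simp [commit]
  rw [strategyValue_eq]
  simp only [hG.sum_offline u₀, h, hG.w_eq]
  simp

/-- Putting all mass on a heaviest arrived vertex is feasible. An optimum of total mass `m` earns at
most `m` times that weight, which is positive, so `m ≥ 1`; ties between optima do not matter. -/
lemma IsSecretary.one_le_sum_arrivalMarginal {G : StochasticGraph} {B : ℝ} {z : G.V}
    (hG : G.IsSecretary B z) (u₀ : G.U) (hB : 1 ≤ B) {solve : LPRule}
    (hsolve : ∀ H : StochasticGraph, H.IsLPOptimum (solve H)) (T : Finset G.V) (hT : T.Nonempty) :
    1 ≤ ∑ v ∈ T, G.arrivalMarginal solve T v u₀ := by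
  obtain ⟨v₀, hv₀, hmax⟩ := T.exists_max_image (fun v => G.w u₀ v) hT
  have hw : 1 ≤ G.w u₀ v₀ := by
    rw [hG.w_eq]
    split_ifs <;> linarith
  let y : G.V → G.U → ℝ := fun v _ => if v = v₀ then 1 else 0
  have hy : ∀ v, y v ∈ G.vertexPolytope v := by
    intro v
    by_cases h : v = v₀
    · have hm : firstActive (G.p · v) [u₀] = y v := by
        ext u
        simp [firstActive, hG.p_eq, hG.offline_eq u u₀, y, h]
      rw [← hm]
      exact firstActive_mem (List.nodup_singleton _) (by simp) (hG.patience_pos v)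
    · have : y v = 0 := by
        ext u
        simp [y, h]
      rw [this]
      exact zero_mem_probePolytope
  have key := G.sum_le_sum_arrivalMarginal hsolve T y hy fun u => by simp [y, hv₀]
  simp only [hG.sum_offline u₀, y, mul_ite, mul_one, mul_zero, Finset.sum_ite_eq', hv₀,
    if_true] at key
  have h2 : ∑ v ∈ T, G.w u₀ v * G.arrivalMarginal solve T v u₀ ≤
      G.w u₀ v₀ * ∑ v ∈ T, G.arrivalMarginal solve T v u₀ := by
    rw [Finset.mul_sum]
    exact Finset.sum_le_sum fun v hv =>
      mul_le_mul_of_nonneg_right (hmax v hv) (G.arrivalMarginal_nonneg hsolve T v u₀)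
  have h3 := key.trans h2
  by_contra h
  nlinarith

/-- Weight `B` is earned only if `z` finds the offline vertex free, which has the secretary
probability; each arrival adds at most `1` otherwise, hence the crude term `n`. -/
lemma IsSecretary.algValue_le {G : StochasticGraph} {B : ℝ} {z : G.V}
    (hG : G.IsSecretary B z) (u₀ : G.U) (hB : 1 ≤ B) {solve : LPRule}
    (hsolve : ∀ H : StochasticGraph, H.IsLPOptimum (solve H)) (α : ℝ) :
    algValue α solve G ≤ B * secretaryProb G.numOnline α + G.numOnline := by
  have hn : (0 : ℝ) < G.numOnline := by exact_mod_cast Fintype.card_pos_iff.2 ⟨z⟩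
  have : Nonempty G.ArrivalOrder := ⟨(Fintype.equivFin G.V).symm⟩
  have hcard : (0 : ℝ) < Fintype.card G.ArrivalOrder := by exact_mod_cast Fintype.card_pos
  rw [algValue_eq, div_le_iff₀ hcard]
  have hrhs : (B * secretaryProb G.numOnline α + G.numOnline) * Fintype.card G.ArrivalOrder =
      ∑ t : Fin G.numOnline, (B * (if ((t.val + 1 : ℕ) : ℝ) < G.numOnline * α then 0 else
        ∏ s : Fin G.numOnline, (if s.val < t.val then
        1 - (if ((s.val + 1 : ℕ) : ℝ) < G.numOnline * α then 0 else 1) / ((s.val : ℝ) + 1) else 1)) *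
        (Fintype.card G.ArrivalOrder / G.numOnline) + Fintype.card G.ArrivalOrder) := by
    rw [Finset.sum_add_distrib, ← Finset.sum_mul, ← Finset.mul_sum]
    simp only [Finset.sum_const, Finset.card_univ, Fintype.card_fin, nsmul_eq_mul]
    unfold secretaryProb
    ring
  rw [hrhs]
  refine Finset.sum_le_sum fun t _ => ?_
  split_ifs with ht
  · simp only [mul_zero, zero_mul, zero_add]
    exact hcard.le
  rw [hG.sum_offline u₀]
  set c : Fin G.numOnline → ℝ := fun s => if ((s.val + 1 : ℕ) : ℝ) < G.numOnline * α then 0 else 1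
    with hc
  set q : Fin G.numOnline → Finset G.V → G.V → ℝ := fun s T v =>
    if ((s.val + 1 : ℕ) : ℝ) < G.numOnline * α then 0 else G.arrivalMarginal solve T v u₀ with hq
  let H : G.ArrivalOrder → ℝ := fun σ => if σ t = z then 1 else 0
  have hq0 : ∀ s T v, 0 ≤ q s T v := by
    intro s T v
    simp only [hq]
    split_ifs
    · exact le_rfl
    · exact G.arrivalMarginal_nonneg hsolve _ _ _
  have hq1 : ∀ s T v, q s T v ≤ 1 := by
    intro s T v
    simp only [hq]
    split_ifs
    · exact zero_le_one
    · exact G.arrivalMarginal_le_one hsolve _ _ _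
  -- The upper bound (`ε = -1`), applied conditionally on `z` being arrival `t`.
  have key := G.sum_mul_prod_one_sub (-1) q c ?_ hq1 ?_ t.val t.2.le H ?_ ?_
  rotate_left
  · intro s
    simp only [hc]
    split_ifs <;> norm_num
  · intro s T hT
    simp only [hc, hq]
    split_ifs
    · simp
    · have := hG.one_le_sum_arrivalMarginal u₀ hB hsolve T hT
      linarith
  · intro σ
    simp only [H]
    split_ifs <;> norm_num
  · intro i j hi hj σ
    simp only [H]
    rw [Equiv.trans_apply,
      Equiv.swap_apply_of_ne_of_ne (fun h => by simp [h] at hi) (fun h => by simp [h] at hj)]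
  have hsum : ∑ σ, H σ = Fintype.card G.ArrivalOrder / G.numOnline := by
    rw [eq_div_iff hn.ne', mul_comm]
    refine (G.sum_apply_arrival t fun v => if v = z then 1 else 0).trans ?_
    simp
  rw [hsum] at key
  have hprod : ∀ σ : G.ArrivalOrder, 0 ≤ ∏ s : Fin G.numOnline,
      (if s.val < t.val then 1 - q s (G.arrived σ s) (σ s) else 1) ∧ ∏ s : Fin G.numOnline,
      (if s.val < t.val then 1 - q s (G.arrived σ s) (σ s) else 1) ≤ 1 := by
    intro σ
    have h0 : ∀ s : Fin G.numOnline,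
        0 ≤ (if s.val < t.val then 1 - q s (G.arrived σ s) (σ s) else 1) := fun s => by
      split_ifs
      · linarith [hq1 s (G.arrived σ s) (σ s)]
      · exact zero_le_one
    refine ⟨Finset.prod_nonneg fun s _ => h0 s, Finset.prod_le_one (fun s _ => h0 s) fun s _ => ?_⟩
    split_ifs
    · linarith [hq0 s (G.arrived σ s) (σ s)]
    · exact le_rfl
  have hterm : ∀ σ : G.ArrivalOrder,
      G.w u₀ (σ t) * G.arrivalMarginal solve (G.arrived σ t) (σ t) u₀ *
        ∏ s : Fin G.numOnline, (if s.val < t.val then 1 - q s (G.arrived σ s) (σ s) else 1) ≤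
      B * (H σ * ∏ s : Fin G.numOnline,
        (if s.val < t.val then 1 - q s (G.arrived σ s) (σ s) else 1)) + 1 := by
    intro σ
    obtain ⟨hp0, hp1⟩ := hprod σ
    set π := ∏ s : Fin G.numOnline, (if s.val < t.val then 1 - q s (G.arrived σ s) (σ s) else 1)
    have ha0 := G.arrivalMarginal_nonneg hsolve (G.arrived σ t) (σ t) u₀
    have ha1 := G.arrivalMarginal_le_one hsolve (G.arrived σ t) (σ t) u₀
    have hw : G.w u₀ (σ t) = if σ t = z then B else 1 := hG.w_eq _ _
    rw [hw]
    simp only [H]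
    have h1 : G.arrivalMarginal solve (G.arrived σ t) (σ t) u₀ * π ≤ π :=
      mul_le_of_le_one_left hp0 ha1
    split_ifs
    · have := mul_le_mul_of_nonneg_left h1 (by linarith : (0 : ℝ) ≤ B)
      linarith
    · linarith
  refine (Finset.sum_le_sum fun σ _ => hterm σ).trans ?_
  rw [Finset.sum_add_distrib, ← Finset.mul_sum]
  simp only [Finset.sum_const, Finset.card_univ, nsmul_eq_mul, mul_one]
  have := mul_le_mul_of_nonneg_left key (by linarith : (0 : ℝ) ≤ B)
  linarith

/-- One offline vertex and `N + 1` online vertices; all edges are active, one of them has weight `B`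
and all the others have weight `1`. -/
def secretaryGraph (N : ℕ) (B : ℝ) : StochasticGraph where
  U := Unit
  V := Fin (N + 1)
  p _ _ := 1
  p_nonneg _ _ := zero_le_one
  p_le_one _ _ := le_rfl
  w _ v := if v = Fin.last N then B else 1
  patience _ := 1

lemma isSecretary_secretaryGraph (N : ℕ) (B : ℝ) :
    (secretaryGraph N B).IsSecretary B (Fin.last N) :=
  ⟨fun _ _ => rfl, fun _ _ => rfl, fun _ _ => rfl, fun _ => Nat.one_pos⟩

/-- There are graphs with arbitrarily large benchmark on which the ratio is close to `1 / e`. -/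
lemma exists_ratio_lt {solve : LPRule} (hsolve : ∀ H : StochasticGraph, H.IsLPOptimum (solve H))
    {ε : ℝ} (hε : 0 < ε) (M : ℝ) : ∃ G : StochasticGraph, M ≤ G.OPT ∧
      algValue (1 / Real.exp 1) solve G / G.OPT < 1 / Real.exp 1 + ε := by
  -- The size `n = N + 1` makes the error `1 / n` of `secretaryProb_le` less than `ε / 2`; then `B`
  -- is chosen so large that `n / B ≤ ε / 2` and the benchmark is at least `M`.
  obtain ⟨N, hN⟩ := exists_nat_gt (2 / ε + 2)
  have hN2 : (2 : ℝ) ≤ N := by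
    have : 0 < 2 / ε := by positivity
    linarith
  have hN2' : 2 ≤ N := by exact_mod_cast hN2
  set n : ℝ := N + 1 with hn
  have hnpos : 0 < n := by positivity
  set B : ℝ := max (max M 1) (2 * n / ε) with hB
  have hB1 : 1 ≤ B := (le_max_right _ _).trans (le_max_left _ _)
  have hBn : n / B ≤ ε / 2 := by
    have : 2 * n / ε ≤ B := le_max_right _ _
    rw [div_le_iff₀ hε] at this
    rw [div_le_iff₀ (by linarith)]
    linarith
  have hn1 : 1 / n < ε / 2 := by
    have : 2 / ε < n := by linarith
    rw [div_lt_iff₀ hε] at this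
    rw [div_lt_iff₀ hnpos]
    linarith
  have hG := isSecretary_secretaryGraph N B
  have hO : B ≤ (secretaryGraph N B).OPT := hG.le_OPT ()
  refine ⟨secretaryGraph N B, ((le_max_left _ _).trans (le_max_left _ _)).trans hO, ?_⟩
  have hv := hG.algValue_le () hB1 hsolve (1 / Real.exp 1)
  have hcard : (secretaryGraph N B).numOnline = N + 1 := Fintype.card_fin _
  rw [hcard] at hv
  have hs := secretaryProb_le (n := N + 1) (by omega)
  push_cast at hv hs
  have he : 0 ≤ secretaryProb (N + 1) (1 / Real.exp 1) :=
    (by positivity : (0 : ℝ) ≤ 1 / Real.exp 1).trans (le_secretaryProb (by omega))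
  have hBpos : 0 < B := by linarith
  calc algValue (1 / Real.exp 1) solve (secretaryGraph N B) / (secretaryGraph N B).OPT
      ≤ (B * secretaryProb (N + 1) (1 / Real.exp 1) + n) / (secretaryGraph N B).OPT :=
        div_le_div_of_nonneg_right hv (by linarith)
    _ ≤ (B * secretaryProb (N + 1) (1 / Real.exp 1) + n) / B :=
        div_le_div_of_nonneg_left (by positivity) hBpos hO
    _ = secretaryProb (N + 1) (1 / Real.exp 1) + n / B := by field_simp
    _ < 1 / Real.exp 1 + ε := by linarith

end StochasticGraph

/-! ### The limit inferior. -/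

theorem theorem5p2 (solve : StochasticGraph.LPRule)
    (hsolve : ∀ H : StochasticGraph, H.IsLPOptimum (solve H)) :
    StochasticGraph.asymptoticCompetitiveRatio
        (StochasticGraph.algValue (1 / Real.exp 1) solve) =
      ((1 / Real.exp 1 : ℝ) : EReal) := by
  unfold StochasticGraph.asymptoticCompetitiveRatio
  refine le_antisymm ?_ ?_
  -- For each real `c > 1 / e`, graphs of ratio below `c` exist beyond every level of the benchmark,
  -- which is frequency along the pulled-back filter.
  · refine EReal.le_of_forall_lt_iff_le.1 fun c hc => ?_
    have hc' : 1 / Real.exp 1 < c := EReal.coe_lt_coe_iff.1 hc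
    refine Filter.liminf_le_of_frequently_le ?_
    rw [Filter.frequently_comap, Filter.frequently_atTop]
    intro M
    obtain ⟨G, hM, hG⟩ := StochasticGraph.exists_ratio_lt hsolve (sub_pos.2 hc') M
    refine ⟨_, hM, G, rfl, EReal.coe_le_coe_iff.2 ?_⟩
    linarith
  -- The bound holds on every graph with positive benchmark, hence eventually.
  · refine Filter.le_liminf_of_le ?_ ?_
    · isBoundedDefault
    · filter_upwards [Filter.preimage_mem_comap (Filter.Ioi_mem_atTop (0 : ℝ))] with G hG
      exact EReal.coe_le_coe_iff.2 (G.ratio_ge hsolve hG)
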